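/- \textbf{Setting.} Let $n\ge 1$ bins be initially empty, and let $x^{(t)}=(x^{(t)}_1,\dots,x^{(t)}_n)$ be the load vector after $t$ balls. A rank function at $x^{(t)}$ is a bijection $\mathrm{Rank}^{(t)}$ from the bins to $\{1,\dots,n\}$ that orders the bins by non-increasing load (ties broken by any rule that depends on the time and the load vector), and $\mathrm{Gap}(t)=\max_i x_i^{(t)}-t/n$. For an integer $d\ge 2$ and quantiles $\delta_1,\dots,\delta_{d-1}\in(0,1]$, the \emph{$d$-Thinning process induced by} $\delta_1,\dots,\delta_{d-1}$ allocates each ball as follows: up to $d$ bins are sampled one after another, uniformly and independently (of each other and of the past). For $1\le j\le d-1$, the $j$-th sampled bin $b$ is rejected if $\mathrm{Rank}^{(t)}(b)\le n\,\delta_j$, and otherwise it receives the ball; if the first $d-1$ samples are all rejected, the $d$-th sampled bin receives the ball. \textbf{Lemma.} Let $\kappa=1/\log(10^4)$ ($\log$ is the natural logarithm). There is an absolute constant $c>0$ such that the following holds for all integers $n$ and $d$ with $2\le d<\kappa\log\log n$. Let $\tilde\delta_1=\tfrac12$ and \[ \tilde\delta_j=2^{-0.5\,(\log n)^{(j-1)/(d-1)}}\qquad(2\le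 j\le d-1), \] and let $\delta_j=\lceil n\tilde\delta_j\rceil/n$ be $\tilde\delta_j$ rounded up to the nearest multiple of $1/n$. Then for every $m\ge 1$, the $d$-Thinning process induced by $\delta_1,\dots,\delta_{d-1}$ satisfies \[ \Pr\left[\mathrm{Gap}(m)\le c\,(d-1)\,(\log n)^{1/(d-1)}\right]\ \ge\ 1-n^{-2}. \] -/

import Mathlib

open MeasureTheory ProbabilityTheory

noncomputable section

/-- `σ` ranks the bins by decreasing load, ties being broken in any way:
`σ i = 0` for a most loaded bin, so the rank of bin `i` in `{1, …, n}` is `σ i + 1`. -/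
def IsRanking {n : ℕ} (x : Fin n → ℕ) (σ : Equiv.Perm (Fin n)) : Prop :=
  ∀ i j : Fin n, x i < x j → σ j < σ i

/-- `Gap = max_i x_i - t / n` for a load vector `x` after `t` balls. -/
def gap {n : ℕ} (x : Fin n → ℕ) (t : ℕ) : ℝ :=
  (⨆ i : Fin n, (x i : ℝ)) - (t : ℝ) / n

/-- The index in `{1, …, d}` of the sample that receives the ball, when `reject j` says that the
`j`-th sample is rejected: the first sample that is not rejected, and the `d`-th sample (which has
to be accepted) if the first `d - 1` samples are all rejected. -/
def acceptedIndex (d : ℕ) (reject : ℕ → Prop) : ℕ :=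
  sInf {j : ℕ | 1 ≤ j ∧ (j < d → ¬ reject j)}

/-- Load vector of the `d`-thinning process after `t` balls. Here `s t j` (`1 ≤ j ≤ d`) is the
`j`-th bin sampled for the ball thrown at load vector `x^{(t)}`, and `reject t x j b` says that the
overseer rejects bin `b` in the `j`-th decision of that step when the current load vector is `x`. -/
def thinningLoad {n : ℕ} (d : ℕ) (reject : ℕ → (Fin n → ℕ) → ℕ → Fin n → Prop)
    (s : ℕ → ℕ → Fin n) : ℕ → Fin n → ℕ
  | 0 => fun _ => 0
  | t + 1 => fun i =>
      thinningLoad d reject s t i +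
        if s t (acceptedIndex d
            fun j => reject t (thinningLoad d reject s t) j (s t j)) = i then 1 else 0

/-- Thinning decisions induced by quantiles `δ 1, δ 2, …`: the `j`-th sampled bin is rejected iff
its rank is at most `n * δ j`. The rank permutation at step `t` and load vector `x` is `rk t x`. -/
def quantileReject {n : ℕ} (δ : ℕ → ℝ) (rk : ℕ → (Fin n → ℕ) → Equiv.Perm (Fin n))
    (t : ℕ) (x : Fin n → ℕ) (j : ℕ) (b : Fin n) : Prop :=
  (((rk t x b : ℕ) + 1 : ℕ) : ℝ) ≤ n * δ j

/-- The quantiles before rounding: `1 / 2` for the first decision and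
`2 ^ (-0.5 * (log n) ^ ((j - 1) / (d - 1)))` for the `j`-th decision, `2 ≤ j ≤ d - 1`. -/
def rawQuantile (n d j : ℕ) : ℝ :=
  if j = 1 then 1 / 2
  else (2 : ℝ) ^ (-(1 / 2 : ℝ) * (Real.log n) ^ (((j : ℝ) - 1) / ((d : ℝ) - 1)))

/-- The quantile of the `j`-th decision, rounded up to the nearest multiple of `1 / n`. -/
def thinningQuantile (n d j : ℕ) : ℝ :=
  (⌈(n : ℝ) * rawQuantile n d j⌉ : ℝ) / n

/-- The constant `κ = 1 / log (10 ^ 4)`. -/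
def kappa : ℝ := 1 / Real.log (10 ^ 4)

end

/-!
The proof is a layered induction over exponential potentials of the excess loads
`y i = v i - (∑ j, v j) / n`. Write `k = d - 1` for the number of quantiles and
`g = (log n) ^ (1 / k)`, which is at least `10 ^ 4` in the given range of `d`; the `(j + 1)`-th
quantile is about `2 ^ (-g ^ j / 2)`.

*Base layer.* The first quantile makes every bin in the more loaded half of the ranking less likely
than average to be chosen, and every other bin more likely. Hence the two-sided potential
`∑ i, (exp (α * y i) + exp (-α * y i))` contracts towards order `n` in expectation, for a small
constant `α` (`two_sided_drift`, `sum_mul_coshPotential_le`). This holds at all times, so that by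
Markov's inequality all excess loads are `O(log n) = O(g ^ k)` throughout a window of polynomial
length before time `m`.

*Upper layers.* Suppose that at most a proportion `2 ^ (-g ^ j / 2)` of the bins has excess at least
`z j`, where `z j` is a constant multiple of `j * g`. These bins are rejected by the first `j + 1`
decisions, so each is chosen with probability `O(2 ^ (-g ^ j / 2)) / n`
(`Regime.recipientProb_le_of_reject`). Therefore the potential `∑ i, exp (β * (y i - z j))`
contracts for exponents `β` up to a constant multiple of `g ^ j` (`sum_mul_expPotential_le`), which bounds the
excess loads by `z j + O(g ^ k / g ^ j)`. For the last layer `j = k - 1`, this bound is `O(k * g)`,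
which is the claim.

*From one layer to the next.* The induction needs a potential of order `n` at all times of a window,
and Markov's inequality only gives a bound of the form `n ^ C`. However, for an exponent a hundred
times smaller, the bound on the excess loads just obtained says that a single bin contributes at
most `n ^ 0.12` to the potential `V`. Then `exp (lam * V)` with `lam = n ^ (-1 / 4)` satisfies
`E exp (lam * V') ≤ exp (lam * ((1 - r) * V + b))`, and by convexity it has again a linear drift
(`exp_mul_drift_le`). Markov's inequality for this exponential gives `V = O(n)`, up to a factor
exponential in `g ^ j`, with a failure probability smaller than any power of `n`. At the level
`z (j + 1)` this leaves few enough bins for the next quantile.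

All these steps are instances of one statement on potentials with a multiplicative drift,
`measureReal_stage_le`, in which each stage gets `n ^ 3` steps to recover from the worst load vector
that the previous stages admit.
-/

noncomputable section


/-! ### The thinning process as a Markov chain -/

theorem acceptedIndex_eq_iff {d : ℕ} (hd : 1 ≤ d) (rej : ℕ → Prop) (j : ℕ) :
    acceptedIndex d rej = j ↔
      1 ≤ j ∧ j ≤ d ∧ (∀ l, 1 ≤ l → l < j → rej l) ∧ (j < d → ¬ rej j) := by
  have hne : {j : ℕ | 1 ≤ j ∧ (j < d → ¬ rej j)}.Nonempty :=
    ⟨d, hd, fun h => absurd h (lt_irrefl d)⟩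
  have hmem := Nat.sInf_mem hne
  have hle : acceptedIndex d rej ≤ d :=
    Nat.sInf_le (show 1 ≤ d ∧ (d < d → ¬ rej d) from ⟨hd, fun h => absurd h (lt_irrefl d)⟩)
  constructor
  · rintro rfl
    refine ⟨hmem.1, hle, fun l hl hlt => ?_, hmem.2⟩
    have := Nat.notMem_of_lt_sInf hlt
    simp only [Set.mem_ofPred_eq, not_and, Classical.not_imp, not_not] at this
    exact (this hl).2
  · rintro ⟨h1, h2, h3, h4⟩
    refine le_antisymm (Nat.sInf_le ⟨h1, h4⟩) ?_
    by_contra! hlt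
    exact hmem.2 (lt_of_lt_of_le hlt h2) (h3 _ hmem.1 hlt)

/-- The bin receiving the ball thrown at time `t`, if the load vector is `v` at that time. -/
def recipient {n : ℕ} {Ω : Type*} (d : ℕ) (rej : ℕ → (Fin n → ℕ) → ℕ → Fin n → Prop)
    (B : ℕ → ℕ → Ω → Fin n) (t : ℕ) (v : Fin n → ℕ) (ω : Ω) : Fin n :=
  B t (acceptedIndex d fun j => rej t v j (B t j ω)) ω

/-- The load vector after `t` balls as a random variable. -/
def loadAt {n : ℕ} {Ω : Type*} (d : ℕ) (rej : ℕ → (Fin n → ℕ) → ℕ → Fin n → Prop)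
    (B : ℕ → ℕ → Ω → Fin n) (t : ℕ) (ω : Ω) : Fin n → ℕ :=
  thinningLoad d rej (fun t j => B t j ω) t

/-- The transition probability of the chain of load vectors: the probability that bin `i` receives
the ball thrown at time `t` at the load vector `v`. -/
def recipientProb {n : ℕ} {Ω : Type*} [MeasurableSpace Ω] (P : Measure Ω) (d : ℕ)
    (rej : ℕ → (Fin n → ℕ) → ℕ → Fin n → Prop)
    (B : ℕ → ℕ → Ω → Fin n) (t : ℕ) (v : Fin n → ℕ) (i : Fin n) : ℝ :=
  P.real {ω | recipient d rej B t v ω = i}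

/-- The σ-algebra generated by the samples drawn at the times in `S`. -/
@[reducible] def sampleSigma {n : ℕ} {Ω : Type*} (B : ℕ → ℕ → Ω → Fin n) (S : Set ℕ) :
    MeasurableSpace Ω :=
  ⨆ q ∈ {q : ℕ × ℕ | q.1 ∈ S}, MeasurableSpace.comap (B q.1 q.2) inferInstance

section Chain

variable {n : ℕ} {Ω : Type*} {d : ℕ} {rej : ℕ → (Fin n → ℕ) → ℕ → Fin n → Prop}
  {B : ℕ → ℕ → Ω → Fin n}

theorem loadAt_zero (ω : Ω) : loadAt d rej B 0 ω = 0 := rfl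

theorem loadAt_succ (t : ℕ) (ω : Ω) :
    loadAt d rej B (t + 1) ω =
      loadAt d rej B t ω + Pi.single (recipient d rej B t (loadAt d rej B t ω) ω) 1 := by
  funext i
  simp only [loadAt, thinningLoad, recipient, Pi.add_apply, Pi.single_apply, eq_comm]

theorem sum_loadAt (t : ℕ) (ω : Ω) : ∑ i, loadAt d rej B t ω i = t := by
  induction t with
  | zero => simp [loadAt_zero]
  | succ t ih => simp [loadAt_succ, Finset.sum_add_distrib, ih]

theorem sampleSigma_mono {S T : Set ℕ} (h : S ⊆ T) : sampleSigma B S ≤ sampleSigma B T :=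
  biSup_mono fun _ hq => h hq

theorem measurableSet_sampleSigma {S : Set ℕ} {t : ℕ} (ht : t ∈ S) (j : ℕ) (s : Set (Fin n)) :
    MeasurableSet[sampleSigma B S] (B t j ⁻¹' s) := by
  have h : MeasurableSpace.comap (B t j) inferInstance ≤ sampleSigma B S :=
    le_biSup (fun q : ℕ × ℕ => MeasurableSpace.comap (B q.1 q.2) inferInstance)
      (show ((t, j) : ℕ × ℕ) ∈ {q : ℕ × ℕ | q.1 ∈ S} from ht)
  exact h _ ⟨s, MeasurableSet.of_discrete, rfl⟩

/-- The samples `1, …, j - 1` drawn at time `t` are rejected and the `j`-th one is bin `i`. -/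
def passEvent (rej : ℕ → (Fin n → ℕ) → ℕ → Fin n → Prop)
    (B : ℕ → ℕ → Ω → Fin n) (t : ℕ) (v : Fin n → ℕ) (i : Fin n) (j : ℕ) : Set Ω :=
  ⋂ l ∈ Finset.Icc 1 j, B t l ⁻¹' (if l = j then {i} else {b | rej t v l b})

theorem mem_passEvent {t : ℕ} {v : Fin n → ℕ} {i : Fin n} {j : ℕ} (hj : 1 ≤ j) {ω : Ω} :
    ω ∈ passEvent rej B t v i j ↔
      (∀ l, 1 ≤ l → l < j → rej t v l (B t l ω)) ∧ B t j ω = i := by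
  simp only [passEvent, Set.mem_iInter, Finset.mem_Icc, Set.mem_preimage]
  constructor
  · intro h
    refine ⟨fun l h1 h2 => ?_, ?_⟩
    · have := h l ⟨h1, h2.le⟩
      rwa [if_neg h2.ne] at this
    · have := h j ⟨hj, le_rfl⟩
      rwa [if_pos rfl] at this
  · rintro ⟨h1, h2⟩ l ⟨h3, h4⟩
    split_ifs with h
    · subst h; exact h2
    · exact h1 l h3 (lt_of_le_of_ne h4 h)

open Classical in
theorem recipient_eq_iUnion (hd : 1 ≤ d) (t : ℕ) (v : Fin n → ℕ) (i : Fin n) :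
    {ω | recipient d rej B t v ω = i} =
      ⋃ j ∈ (Finset.Icc 1 d).filter (fun j => j < d → ¬ rej t v j i),
        passEvent rej B t v i j := by
  ext ω
  simp only [Set.mem_ofPred_eq, Set.mem_iUnion, Finset.mem_filter, Finset.mem_Icc, exists_prop]
  constructor
  · intro h
    obtain ⟨h1, h2, h3, h4⟩ :=
      (acceptedIndex_eq_iff hd (fun j => rej t v j (B t j ω)) _).1 rfl
    unfold recipient at h
    refine ⟨_, ⟨⟨h1, h2⟩, fun hlt => ?_⟩, (mem_passEvent h1).2 ⟨h3, h⟩⟩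
    have := h4 hlt
    rwa [h] at this
  · rintro ⟨j, ⟨⟨h1, h2⟩, h3⟩, h4⟩
    obtain ⟨h5, h6⟩ := (mem_passEvent h1).1 h4
    have : acceptedIndex d (fun j => rej t v j (B t j ω)) = j :=
      (acceptedIndex_eq_iff hd _ _).2 ⟨h1, h2, h5, fun hlt => by rw [h6]; exact h3 hlt⟩
    unfold recipient
    rw [this, h6]

theorem measurableSet_passEvent {S : Set ℕ} {t : ℕ} (ht : t ∈ S) (v : Fin n → ℕ) (i : Fin n)
    (j : ℕ) : MeasurableSet[sampleSigma B S] (passEvent rej B t v i j) := by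
  unfold passEvent
  exact Finset.measurableSet_biInter _ fun l _ => measurableSet_sampleSigma ht l _

theorem measurableSet_recipient (hd : 1 ≤ d) {S : Set ℕ} {t : ℕ} (ht : t ∈ S) (v : Fin n → ℕ)
    (i : Fin n) : MeasurableSet[sampleSigma B S] {ω | recipient d rej B t v ω = i} := by
  classical
  rw [recipient_eq_iUnion hd]
  exact Finset.measurableSet_biUnion _ fun j _ => measurableSet_passEvent ht v i j

theorem measurableSet_loadAt (hd : 1 ≤ d) (t : ℕ) (s : Set (Fin n → ℕ)) :
    MeasurableSet[sampleSigma B (Set.Iio t)] {ω | loadAt d rej B t ω ∈ s} := by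
  induction t generalizing s with
  | zero => simp only [loadAt_zero]; exact MeasurableSet.const _
  | succ t ih =>
    have : {ω | loadAt d rej B (t + 1) ω ∈ s} =
        ⋃ v : Fin n → ℕ, ⋃ i : Fin n, {ω | loadAt d rej B t ω ∈ ({v} : Set (Fin n → ℕ))} ∩
          {ω | recipient d rej B t v ω = i} ∩ {_ω | v + Pi.single i 1 ∈ s} := by
      ext ω
      simp only [loadAt_succ, Set.mem_ofPred_eq, Set.mem_iUnion, Set.mem_inter_iff,
        Set.mem_singleton_iff]
      constructor
      · exact fun h => ⟨_, _, ⟨rfl, rfl⟩, h⟩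
      · rintro ⟨v, i, ⟨rfl, rfl⟩, h⟩; exact h
    rw [this]
    refine MeasurableSet.iUnion fun v => MeasurableSet.iUnion fun i => ?_
    refine MeasurableSet.inter (MeasurableSet.inter ?_ ?_) (MeasurableSet.const _)
    · exact sampleSigma_mono (Set.Iio_subset_Iio (Nat.le_succ t)) _ (ih {v})
    · exact measurableSet_recipient hd (by simp) v i

/-- The load vectors of `n` bins in which no bin has more than `t` balls. -/
def boundedLoads (n t : ℕ) : Finset (Fin n → ℕ) := Fintype.piFinset fun _ => Finset.range (t + 1)

theorem loadAt_mem_boundedLoads (t : ℕ) (ω : Ω) : loadAt d rej B t ω ∈ boundedLoads n t := by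
  simp only [boundedLoads, Fintype.mem_piFinset, Finset.mem_range, Nat.lt_succ_iff]
  intro i
  calc loadAt d rej B t ω i ≤ ∑ i, loadAt d rej B t ω i :=
        Finset.single_le_sum (f := loadAt d rej B t ω) (fun _ _ => Nat.zero_le _)
          (Finset.mem_univ i)
    _ = t := sum_loadAt t ω

theorem comp_loadAt_eq_sum (f : (Fin n → ℕ) → ℝ) (t : ℕ) (ω : Ω) :
    f (loadAt d rej B t ω) = ∑ v ∈ boundedLoads n t,
      {ω | loadAt d rej B t ω ∈ ({v} : Set (Fin n → ℕ))}.indicator (fun _ => f v) ω := by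
  rw [Finset.sum_eq_single_of_mem _ (loadAt_mem_boundedLoads t ω)]
  · rw [Set.indicator_of_mem]
    exact Set.mem_singleton _
  · intro v _ hv
    rw [Set.indicator_of_notMem]
    exact fun h => hv (Set.mem_singleton_iff.1 h).symm

/-- The load vector satisfies `Good` at all times in `[a, t]`. -/
def goodOn (d : ℕ) (rej : ℕ → (Fin n → ℕ) → ℕ → Fin n → Prop) (B : ℕ → ℕ → Ω → Fin n)
    (Good : (Fin n → ℕ) → Prop) (a t : ℕ) : Set Ω :=
  {ω | ∀ s, a ≤ s → s ≤ t → Good (loadAt d rej B s ω)}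

theorem measurableSet_goodOn (hd : 1 ≤ d) (Good : (Fin n → ℕ) → Prop) (a t : ℕ) :
    MeasurableSet[sampleSigma B (Set.Iio t)] (goodOn d rej B Good a t) := by
  have : goodOn d rej B Good a t =
      ⋂ s ∈ Finset.Icc a t, {ω | loadAt d rej B s ω ∈ {v | Good v}} := by
    ext ω; simp [goodOn, Finset.mem_Icc]
  rw [this]
  refine Finset.measurableSet_biInter _ fun s hs => ?_
  exact sampleSigma_mono (Set.Iio_subset_Iio (Finset.mem_Icc.1 hs).2) _
    (measurableSet_loadAt hd s _)

variable [MeasurableSpace Ω] {P : Measure Ω}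

theorem sampleSigma_le (hB : ∀ t j, Measurable (B t j)) (S : Set ℕ) :
    sampleSigma B S ≤ ‹MeasurableSpace Ω› :=
  iSup₂_le fun q _ => (hB q.1 q.2).comap_le

theorem indep_sampleSigma (hB : ∀ t j, Measurable (B t j))
    (hind : iIndepFun (fun p : ℕ × ℕ => B p.1 p.2) P) {S T : Set ℕ} (h : Disjoint S T) :
    Indep (sampleSigma B S) (sampleSigma B T) P := by
  refine indep_iSup_of_disjoint (m := fun q : ℕ × ℕ =>
    MeasurableSpace.comap (B q.1 q.2) inferInstance) (fun q => (hB q.1 q.2).comap_le) hind ?_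
  rw [Set.disjoint_left] at h ⊢
  exact fun q hq hq' => h hq hq'

/-- The Markov property of the chain of load vectors. -/
theorem measureReal_inter_recipient (hd : 1 ≤ d) (hB : ∀ t j, Measurable (B t j))
    (hind : iIndepFun (fun p : ℕ × ℕ => B p.1 p.2) P) {t : ℕ} {A : Set Ω}
    (hA : MeasurableSet[sampleSigma B (Set.Iio t)] A) (v : Fin n → ℕ) (i : Fin n) :
    P.real (A ∩ {ω | recipient d rej B t v ω = i}) = P.real A * recipientProb P d rej B t v i := by
  have h := (Indep_iff _ _ _).1
    (indep_sampleSigma hB hind (S := Set.Iio t) (T := {t}) (by simp)) _ _ hA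
    (measurableSet_recipient (rej := rej) hd (Set.mem_singleton t) v i)
  simp only [recipientProb, measureReal_def, h, ENNReal.toReal_mul]

theorem recipientProb_nonneg (t : ℕ) (v : Fin n → ℕ) (i : Fin n) :
    0 ≤ recipientProb P d rej B t v i := measureReal_nonneg

variable [IsProbabilityMeasure P]

theorem sum_recipientProb (hd : 1 ≤ d) (hB : ∀ t j, Measurable (B t j)) (t : ℕ) (v : Fin n → ℕ) :
    ∑ i, recipientProb P d rej B t v i = 1 := by
  unfold recipientProb
  rw [← measureReal_biUnion_finset]
  · rw [← probReal_univ (μ := P)]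
    congr 1
    ext ω; simp
  · intro i _ j _ hij
    simp only [Function.onFun]
    rw [Set.disjoint_left]
    rintro ω h1 h2
    exact hij (h1.symm.trans h2)
  · exact fun i _ => sampleSigma_le hB _ _ (measurableSet_recipient hd (Set.mem_singleton t) v i)

open Classical in
/-- The transition probabilities, when the sets of rejected bins have the proportions `δ l`. -/
theorem recipientProb_eq (hd : 1 ≤ d) (hB : ∀ t j, Measurable (B t j))
    (hunif : ∀ t j b, P.real {ω | B t j ω = b} = 1 / (n : ℝ))
    (hind : iIndepFun (fun p : ℕ × ℕ => B p.1 p.2) P) (t : ℕ) (v : Fin n → ℕ) (δ : ℕ → ℝ)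
    (hδ : ∀ l, 1 ≤ l → l < d →
      ((Finset.univ.filter fun b => rej t v l b).card : ℝ) = n * δ l) (i : Fin n) :
    recipientProb P d rej B t v i =
      1 / n * ∑ j ∈ (Finset.Icc 1 d).filter (fun j => j < d → ¬ rej t v j i),
        ∏ l ∈ Finset.Ico 1 j, δ l := by
  have hn : (n : ℝ) ≠ 0 := by
    have := i.pos
    positivity
  have hset : ∀ l (s : Finset (Fin n)), P.real (B t l ⁻¹' s) = s.card / n := by
    intro l s
    have : B t l ⁻¹' (s : Set (Fin n)) = ⋃ b ∈ s, {ω | B t l ω = b} := by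
      ext ω; simp
    rw [this, measureReal_biUnion_finset]
    · simp [hunif, div_eq_mul_inv]
    · intro a _ b _ hab
      simp only [Function.onFun]
      rw [Set.disjoint_left]
      rintro ω h1 h2
      exact hab (h1.symm.trans h2)
    · exact fun b _ => hB t l (measurableSet_singleton b)
  have hind' : iIndepFun (fun l : ℕ => B t l) P :=
    hind.precomp (g := fun l : ℕ => (t, l)) (fun a b h => (Prod.mk.inj h).2)
  unfold recipientProb
  rw [recipient_eq_iUnion hd, measureReal_biUnion_finset, Finset.mul_sum]
  · refine Finset.sum_congr rfl fun j hj => ?_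
    have hj1 : 1 ≤ j ∧ j ≤ d := Finset.mem_Icc.1 (Finset.mem_filter.1 hj).1
    unfold passEvent
    rw [measureReal_def, hind'.meas_biInter (S := Finset.Icc 1 j)
      (fun l _ => ⟨_, MeasurableSet.of_discrete, rfl⟩), ENNReal.toReal_prod]
    have hsplit : Finset.Icc 1 j = insert j (Finset.Ico 1 j) := by
      ext a; simp only [Finset.mem_Icc, Finset.mem_insert, Finset.mem_Ico]; omega
    rw [hsplit, Finset.prod_insert (by simp)]
    congr 1
    · have := hset j {i}
      simpa [measureReal_def] using this
    · refine Finset.prod_congr rfl fun l hl => ?_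
      have hl' := Finset.mem_Ico.1 hl
      rw [if_neg hl'.2.ne]
      have h1 := hset l (Finset.univ.filter fun b => rej t v l b)
      rw [hδ l hl'.1 (by omega), mul_div_cancel_left₀ _ hn] at h1
      simpa [measureReal_def] using h1
  · intro a ha b hb hab
    simp only [Function.onFun]
    have ha' := Finset.mem_filter.1 ha
    have hb' := Finset.mem_filter.1 hb
    rw [Finset.mem_Icc] at ha' hb'
    rw [Set.disjoint_left]
    intro ω h1 h2
    rw [mem_passEvent ha'.1.1] at h1
    rw [mem_passEvent hb'.1.1] at h2
    rcases lt_or_gt_of_ne hab with h | h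
    · exact ha'.2 (by omega) (h1.2 ▸ h2.1 a ha'.1.1 h)
    · exact hb'.2 (by omega) (h2.2 ▸ h1.1 b hb'.1.1 h)
  · exact fun j _ => sampleSigma_le hB _ _ (measurableSet_passEvent (Set.mem_singleton t) v i j)

/-! ### Drift along the chain -/

theorem measurableSet_loadAt_mem (hd : 1 ≤ d) (hB : ∀ t j, Measurable (B t j)) (t : ℕ)
    (s : Set (Fin n → ℕ)) : MeasurableSet {ω | loadAt d rej B t ω ∈ s} :=
  sampleSigma_le hB _ _ (measurableSet_loadAt hd t s)

theorem integrable_comp_loadAt (hd : 1 ≤ d) (hB : ∀ t j, Measurable (B t j))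
    (f : (Fin n → ℕ) → ℝ) (t : ℕ) : Integrable (fun ω => f (loadAt d rej B t ω)) P := by
  simp_rw [comp_loadAt_eq_sum f t]
  exact integrable_finsetSum _ fun v _ =>
    (integrable_const _).indicator (measurableSet_loadAt_mem hd hB t _)

theorem setIntegral_comp_loadAt (hd : 1 ≤ d) (hB : ∀ t j, Measurable (B t j))
    (f : (Fin n → ℕ) → ℝ) (t : ℕ) (A : Set Ω) :
    ∫ ω in A, f (loadAt d rej B t ω) ∂P = ∑ v ∈ boundedLoads n t,
      P.real (A ∩ {ω | loadAt d rej B t ω ∈ ({v} : Set (Fin n → ℕ))}) * f v := by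
  simp_rw [comp_loadAt_eq_sum f t]
  have hint : ∀ v, Integrable ({ω | loadAt d rej B t ω ∈ ({v} : Set (Fin n → ℕ))}.indicator
      fun _ => f v) P := fun v =>
    (integrable_const _).indicator (measurableSet_loadAt_mem hd hB t _)
  rw [integral_finsetSum _ fun v _ => (hint v).integrableOn]
  refine Finset.sum_congr rfl fun v _ => ?_
  rw [setIntegral_indicator (measurableSet_loadAt_mem hd hB t _), setIntegral_const, smul_eq_mul]

theorem setIntegral_comp_loadAt_mono (hd : 1 ≤ d) (hB : ∀ t j, Measurable (B t j))
    {f g : (Fin n → ℕ) → ℝ} {t : ℕ} {A : Set Ω} (hA : MeasurableSet A)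
    (h : ∀ ω ∈ A, f (loadAt d rej B t ω) ≤ g (loadAt d rej B t ω)) :
    ∫ ω in A, f (loadAt d rej B t ω) ∂P ≤ ∫ ω in A, g (loadAt d rej B t ω) ∂P :=
  setIntegral_mono_on (integrable_comp_loadAt hd hB f t).integrableOn
    (integrable_comp_loadAt hd hB g t).integrableOn hA h

theorem setIntegral_comp_loadAt_mono_set (hd : 1 ≤ d) (hB : ∀ t j, Measurable (B t j))
    {f : (Fin n → ℕ) → ℝ} (hf : ∀ v, 0 ≤ f v) (t : ℕ) {A A' : Set Ω} (h : A ⊆ A') :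
    ∫ ω in A, f (loadAt d rej B t ω) ∂P ≤ ∫ ω in A', f (loadAt d rej B t ω) ∂P :=
  setIntegral_mono_set (integrable_comp_loadAt hd hB f t).integrableOn
    (Filter.Eventually.of_forall fun _ => hf _) (Filter.Eventually.of_forall h)

/-- Over an event determined by the past, the load vector at time `t + 1` may be averaged over
the ball thrown at time `t`. -/
theorem setIntegral_comp_loadAt_succ (hd : 1 ≤ d) (hB : ∀ t j, Measurable (B t j))
    (hind : iIndepFun (fun p : ℕ × ℕ => B p.1 p.2) P) (f : (Fin n → ℕ) → ℝ) {t : ℕ} {A : Set Ω}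
    (hA : MeasurableSet[sampleSigma B (Set.Iio t)] A) :
    ∫ ω in A, f (loadAt d rej B (t + 1) ω) ∂P =
      ∫ ω in A, (fun v => ∑ i, recipientProb P d rej B t v i * f (v + Pi.single i 1))
        (loadAt d rej B t ω) ∂P := by
  have hR : ∀ v i, MeasurableSet {ω | recipient d rej B t v ω = i} := fun v i =>
    sampleSigma_le hB _ _ (measurableSet_recipient hd (Set.mem_singleton t) v i)
  have hpt : ∀ ω, f (loadAt d rej B (t + 1) ω) = ∑ v ∈ boundedLoads n t, ∑ i,
      ({ω | loadAt d rej B t ω ∈ ({v} : Set (Fin n → ℕ))} ∩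
        {ω | recipient d rej B t v ω = i}).indicator (fun _ => f (v + Pi.single i 1)) ω := by
    intro ω
    rw [loadAt_succ, Finset.sum_eq_single_of_mem _ (loadAt_mem_boundedLoads t ω),
      Finset.sum_eq_single_of_mem _ (Finset.mem_univ _)]
    · rw [Set.indicator_of_mem]
      exact ⟨rfl, rfl⟩
    · intro i _ hi
      rw [Set.indicator_of_notMem]
      exact fun h => hi h.2.symm
    · intro v _ hv
      refine Finset.sum_eq_zero fun i _ => ?_
      rw [Set.indicator_of_notMem]
      exact fun h => hv h.1.symm
  have hint : ∀ v i, Integrable (({ω | loadAt d rej B t ω ∈ ({v} : Set (Fin n → ℕ))} ∩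
      {ω | recipient d rej B t v ω = i}).indicator fun _ => f (v + Pi.single i 1)) P := fun v i =>
    (integrable_const _).indicator ((measurableSet_loadAt_mem hd hB t _).inter (hR v i))
  refine Eq.trans ?_ (setIntegral_comp_loadAt hd hB
    (fun v => ∑ i, recipientProb P d rej B t v i * f (v + Pi.single i 1)) t A).symm
  rw [integral_congr_ae (Filter.Eventually.of_forall hpt)]
  rw [integral_finsetSum _ fun v _ => (integrable_finsetSum _ fun i _ => hint v i).integrableOn]
  refine Finset.sum_congr rfl fun v _ => ?_
  rw [integral_finsetSum _ fun i _ => (hint v i).integrableOn, Finset.mul_sum]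
  refine Finset.sum_congr rfl fun i _ => ?_
  rw [setIntegral_indicator ((measurableSet_loadAt_mem hd hB t _).inter (hR v i)),
    setIntegral_const,
    smul_eq_mul, ← Set.inter_assoc, measureReal_inter_recipient hd hB hind
      (hA.inter (measurableSet_loadAt hd t _)), mul_assoc]

/-- A potential with a multiplicative drift towards `b` decays geometrically to at most `b` in
expectation, as long as the load vector is good. -/
theorem setIntegral_goodOn_le (hd : 1 ≤ d) (hB : ∀ t j, Measurable (B t j))
    (hind : iIndepFun (fun p : ℕ × ℕ => B p.1 p.2) P) (Good : (Fin n → ℕ) → Prop)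
    (f : (Fin n → ℕ) → ℝ) (hf : ∀ v, 0 ≤ f v) {r b M : ℝ} (hr : 0 ≤ r) (hr1 : r ≤ 1) (hb : 0 ≤ b)
    (hM : 0 ≤ M) {a : ℕ}
    (hdrift : ∀ t v, Good v →
      ∑ i, recipientProb P d rej B t v i * f (v + Pi.single i 1) ≤ (1 - r) * f v + r * b)
    (hstart : ∀ ω, Good (loadAt d rej B a ω) → f (loadAt d rej B a ω) ≤ M) (s : ℕ) :
    ∫ ω in goodOn d rej B Good a (a + s), f (loadAt d rej B (a + s) ω) ∂P ≤
      (1 - r) ^ s * M + b := by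
  induction s with
  | zero =>
    have hle := setIntegral_comp_loadAt_mono (P := P) hd hB (f := f) (g := fun _ => M) (t := a + 0)
      (sampleSigma_le hB _ _ (measurableSet_goodOn hd Good a (a + 0)))
      fun ω hω => hstart ω (hω a le_rfl le_rfl)
    rw [setIntegral_const, smul_eq_mul] at hle
    have : P.real (goodOn d rej B Good a (a + 0)) * M ≤ 1 * M :=
      mul_le_mul_of_nonneg_right measureReal_le_one hM
    simp only [pow_zero]
    linarith
  | succ s ih =>
    have hA := measurableSet_goodOn (rej := rej) (B := B) hd Good a (a + s)
    calc ∫ ω in goodOn d rej B Good a (a + (s + 1)), f (loadAt d rej B (a + (s + 1)) ω) ∂P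
        ≤ ∫ ω in goodOn d rej B Good a (a + s), f (loadAt d rej B (a + s + 1) ω) ∂P := by
          exact setIntegral_comp_loadAt_mono_set hd hB hf (a + s + 1)
            fun ω hω s' h1 h2 => hω s' h1 (by omega)
      _ = ∫ ω in goodOn d rej B Good a (a + s),
            (fun v => ∑ i, recipientProb P d rej B (a + s) v i * f (v + Pi.single i 1))
              (loadAt d rej B (a + s) ω) ∂P := setIntegral_comp_loadAt_succ hd hB hind f hA
      _ ≤ ∫ ω in goodOn d rej B Good a (a + s),
            ((1 - r) * f (loadAt d rej B (a + s) ω) + r * b) ∂P := by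
          exact setIntegral_comp_loadAt_mono (P := P) (t := a + s) hd hB
            (f := fun v => ∑ i, recipientProb P d rej B (a + s) v i * f (v + Pi.single i 1))
            (g := fun v => (1 - r) * f v + r * b) (sampleSigma_le hB _ _ hA)
            fun ω hω => hdrift _ _ (hω _ (Nat.le_add_right _ _) le_rfl)
      _ = (1 - r) * ∫ ω in goodOn d rej B Good a (a + s), f (loadAt d rej B (a + s) ω) ∂P +
            P.real (goodOn d rej B Good a (a + s)) * (r * b) := by
          rw [integral_add ((integrable_comp_loadAt hd hB f _).const_mul _).integrableOn
            (integrable_const _).integrableOn, integral_const_mul, setIntegral_const, smul_eq_mul]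
      _ ≤ (1 - r) * ((1 - r) ^ s * M + b) + 1 * (r * b) := by
          exact add_le_add (mul_le_mul_of_nonneg_left ih (by linarith))
            (mul_le_mul_of_nonneg_right measureReal_le_one (mul_nonneg hr hb))
      _ = (1 - r) ^ (s + 1) * M + b := by ring

/-- One stage of the layered induction. If the load vector is good from time `a` on and a potential
has a multiplicative drift at good load vectors, then the potential is small from time `a'` on, up
to a union bound over the times in `[a', m]`. The recovery time `τ` between `a` and `a'` makes the
potential forget its value at time `a`; it is not needed if `a = 0`, where the bins are empty. -/
theorem measureReal_stage_le (hd : 1 ≤ d) (hB : ∀ t j, Measurable (B t j))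
    (hind : iIndepFun (fun p : ℕ × ℕ => B p.1 p.2) P) (Good : (Fin n → ℕ) → Prop)
    (f : (Fin n → ℕ) → ℝ) (hf : ∀ v, 0 ≤ f v) {r b M K : ℝ} (hr : 0 ≤ r) (hr1 : r ≤ 1)
    (hM : 0 ≤ M) (hK : 0 < K) {a a' m τ : ℕ}
    (hdrift : ∀ t v, Good v →
      ∑ i, recipientProb P d rej B t v i * f (v + Pi.single i 1) ≤ (1 - r) * f v + r * b)
    (hzero : f 0 ≤ b)
    (hstart : a = 0 ∨ ((∀ v, Good v → f v ≤ M) ∧ (1 - r) ^ τ * M ≤ b ∧ a + τ ≤ a'))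
    (haa : a ≤ a') :
    P.real (goodOn d rej B (fun v => Good v ∧ f v ≤ K) a' m)ᶜ ≤
      P.real (goodOn d rej B Good a m)ᶜ + (m + 1 - a' : ℕ) * (2 * b / K) := by
  have hb : 0 ≤ b := (hf 0).trans hzero
  have hint : ∀ t, a' ≤ t →
      ∫ ω in goodOn d rej B Good a t, f (loadAt d rej B t ω) ∂P ≤ 2 * b := by
    intro t ht
    obtain ⟨s, rfl⟩ : ∃ s, t = a + s := ⟨t - a, by omega⟩
    rcases hstart with rfl | ⟨h1, h2, h3⟩
    · have := setIntegral_goodOn_le hd hB hind Good f hf hr hr1 hb hb (a := 0) hdrift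
        (fun ω _ => by rw [loadAt_zero]; exact hzero) s
      have h4 : (1 - r) ^ s * b ≤ 1 * b :=
        mul_le_mul_of_nonneg_right (pow_le_one₀ (by linarith) (by linarith)) hb
      linarith
    · have := setIntegral_goodOn_le hd hB hind Good f hf hr hr1 hb hM (a := a) hdrift
        (fun ω h => h1 _ h) s
      have h4 : (1 - r) ^ s * M ≤ (1 - r) ^ τ * M :=
        mul_le_mul_of_nonneg_right
          (pow_le_pow_of_le_one (by linarith) (by linarith) (by omega)) hM
      linarith
  -- Markov's inequality at a single time
  have hone : ∀ t, a' ≤ t →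
      P.real (goodOn d rej B Good a t ∩ {ω | K < f (loadAt d rej B t ω)}) ≤ 2 * b / K := by
    intro t ht
    rw [le_div_iff₀ hK]
    refine le_trans ?_ (hint t ht)
    have hm1 : MeasurableSet (goodOn d rej B Good a t) :=
      sampleSigma_le hB _ _ (measurableSet_goodOn hd Good _ _)
    have hm2 : MeasurableSet {ω | K < f (loadAt d rej B t ω)} :=
      measurableSet_loadAt_mem hd hB t {v | K < f v}
    calc P.real (goodOn d rej B Good a t ∩ {ω | K < f (loadAt d rej B t ω)}) * K
        = ∫ _ω in goodOn d rej B Good a t ∩ {ω | K < f (loadAt d rej B t ω)}, K ∂P := by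
          rw [setIntegral_const, smul_eq_mul]
      _ ≤ ∫ ω in goodOn d rej B Good a t ∩ {ω | K < f (loadAt d rej B t ω)},
            f (loadAt d rej B t ω) ∂P :=
          setIntegral_comp_loadAt_mono hd hB (f := fun _ => K) (hm1.inter hm2)
            fun ω hω => (show K < _ from hω.2).le
      _ ≤ ∫ ω in goodOn d rej B Good a t, f (loadAt d rej B t ω) ∂P :=
          setIntegral_comp_loadAt_mono_set hd hB hf t Set.inter_subset_left
  have hsub : (goodOn d rej B (fun v => Good v ∧ f v ≤ K) a' m)ᶜ ⊆
      (goodOn d rej B Good a m)ᶜ ∪ ⋃ t ∈ Finset.Icc a' m,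
        (goodOn d rej B Good a t ∩ {ω | K < f (loadAt d rej B t ω)}) := by
    intro ω hω
    by_cases h : ω ∈ goodOn d rej B Good a m
    · right
      simp only [goodOn, Set.mem_compl_iff, Set.mem_ofPred_eq, not_forall, not_and, not_le] at hω
      obtain ⟨t, h1, h2, h3⟩ := hω
      simp only [Set.mem_iUnion, Finset.mem_Icc]
      exact ⟨t, ⟨h1, h2⟩, fun s h4 h5 => h s h4 (by omega), h3 (h t (by omega) h2)⟩
    · exact Or.inl h
  refine (measureReal_mono hsub).trans ((measureReal_union_le _ _).trans ?_)
  gcongr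
  refine (measureReal_biUnion_finset_le _ _).trans ?_
  refine (Finset.sum_le_sum fun t ht => hone t (Finset.mem_Icc.1 ht).1).trans ?_
  simp

end Chain


/-! ### Exponential potentials -/

/-- The load of bin `i` minus the average load. -/
def excess {n : ℕ} (v : Fin n → ℕ) (i : Fin n) : ℝ := v i - (∑ j, (v j : ℝ)) / n

/-- The potential `∑ i, exp (β (y i - z))`, where `y` is the vector of excess loads. -/
def expPotential {n : ℕ} (β z : ℝ) (v : Fin n → ℕ) : ℝ := ∑ i, Real.exp (β * (excess v i - z))

/-- The two-sided (hyperbolic cosine) potential. -/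
def coshPotential {n : ℕ} (α : ℝ) (v : Fin n → ℕ) : ℝ := expPotential α 0 v + expPotential (-α) 0 v

theorem sum_excess {n : ℕ} (v : Fin n → ℕ) : ∑ i, excess v i = 0 := by
  rcases Nat.eq_zero_or_pos n with rfl | hn
  · simp
  · have : (n : ℝ) ≠ 0 := by positivity
    simp only [excess, Finset.sum_sub_distrib, Finset.sum_const, Finset.card_univ, Fintype.card_fin,
      nsmul_eq_mul]
    field_simp
    ring

theorem excess_add_single {n : ℕ} (v : Fin n → ℕ) (i j : Fin n) :
    excess (v + Pi.single i 1) j = excess v j + (if j = i then 1 else 0) - 1 / n := by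
  have h : ∑ k, ((v + Pi.single i 1 : Fin n → ℕ) k : ℝ) = ∑ k, (v k : ℝ) + 1 := by
    simp [Finset.sum_add_distrib, Pi.single_apply]
  unfold excess
  rw [h]
  simp only [Pi.add_apply, Pi.single_apply]
  split_ifs <;> push_cast <;> ring

theorem exp_le_expPotential {n : ℕ} (β z : ℝ) (v : Fin n → ℕ) (i : Fin n) :
    Real.exp (β * (excess v i - z)) ≤ expPotential β z v :=
  Finset.single_le_sum (f := fun i => Real.exp (β * (excess v i - z)))
    (fun _ _ => (Real.exp_pos _).le) (Finset.mem_univ i)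

theorem expPotential_nonneg {n : ℕ} (β z : ℝ) (v : Fin n → ℕ) : 0 ≤ expPotential β z v :=
  Finset.sum_nonneg fun _ _ => (Real.exp_pos _).le

theorem coshPotential_nonneg {n : ℕ} (α : ℝ) (v : Fin n → ℕ) : 0 ≤ coshPotential α v :=
  add_nonneg (expPotential_nonneg _ _ _) (expPotential_nonneg _ _ _)

theorem expPotential_zero_load {n : ℕ} (β z : ℝ) :
    expPotential β z (0 : Fin n → ℕ) = n * Real.exp (-(β * z)) := by
  simp [expPotential, excess]

theorem expPotential_add_single {n : ℕ} (β z : ℝ) (v : Fin n → ℕ) (i : Fin n) :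
    expPotential β z (v + Pi.single i 1) = Real.exp (-(β / n)) *
      (expPotential β z v + Real.exp (β * (excess v i - z)) * (Real.exp β - 1)) := by
  have h : ∀ j, Real.exp (β * (excess (v + Pi.single i 1) j - z)) = Real.exp (-(β / n)) *
      (Real.exp (β * (excess v j - z)) +
        if j = i then Real.exp (β * (excess v i - z)) * (Real.exp β - 1) else 0) := by
    intro j
    rw [excess_add_single]
    split_ifs with hj
    · subst hj
      rw [mul_sub (Real.exp _) (Real.exp β), mul_one, add_sub_cancel, ← Real.exp_add,
        ← Real.exp_add]
      congr 1; ring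
    · rw [add_zero, add_zero, ← Real.exp_add]
      congr 1; ring
  unfold expPotential
  rw [Finset.sum_congr rfl fun j _ => h j, ← Finset.mul_sum, Finset.sum_add_distrib]
  simp

theorem exp_neg_le_one_sub_half {x : ℝ} (h0 : 0 ≤ x) (h1 : x ≤ 1) : Real.exp (-x) ≤ 1 - x / 2 := by
  have h := Real.abs_exp_sub_one_sub_id_le (x := -x) (by rw [abs_neg, abs_of_nonneg h0]; exact h1)
  rw [Real.exp_neg]
  have h2 := Real.add_one_le_exp x
  rw [inv_le_comm₀ (Real.exp_pos _) (by linarith)]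
  refine le_trans ?_ h2
  rw [inv_le_iff_one_le_mul₀ (by linarith)]
  nlinarith

theorem exp_le_one_add_two_mul {x : ℝ} (h0 : 0 ≤ x) (h1 : x ≤ 1) : Real.exp x ≤ 1 + 2 * x := by
  have h := (abs_le.1 (Real.abs_exp_sub_one_sub_id_le (x := x) (by rwa [abs_of_nonneg h0]))).2
  nlinarith

/-- Convexity turns a drift of `V` inside the exponential into a linear drift of `exp (lam * V)`. -/
theorem exp_mul_drift_le {lam r b V : ℝ} (hr : 0 < r) (hr1 : r ≤ 1) :
    Real.exp (lam * ((1 - r) * V + b)) ≤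
      (1 - r) * Real.exp (lam * V) + r * Real.exp (lam * (b / r)) := by
  have h := convexOn_exp.2 (Set.mem_univ (lam * V)) (Set.mem_univ (lam * (b / r)))
    (by linarith : 0 ≤ 1 - r) hr.le (by ring)
  simp only [smul_eq_mul] at h
  refine le_trans (le_of_eq ?_) h
  congr 1
  field_simp

/-! ### Drift of the potentials of the upper layers -/

/-- The expected increase of a one-sided potential: bins above `z` are rarely chosen, and bins
below `z` have weight at most one. -/
theorem sum_mul_gain_le {n : ℕ} {p : Fin n → ℝ} {v : Fin n → ℕ} {β z q : ℝ} (hp : ∀ i, 0 ≤ p i)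
    (hp2 : ∀ i, p i ≤ 2 / n) (hβ : 0 ≤ β) (hq : 0 ≤ q)
    (hhigh : ∀ i, z ≤ excess v i → p i ≤ q / n) :
    ∑ i, p i * (Real.exp (β * (excess v i - z)) * (Real.exp β - 1)) ≤
      q * Real.exp β / n * expPotential β z v + 2 * Real.exp β := by
  have hβ1 : 0 ≤ Real.exp β - 1 := by linarith [Real.add_one_le_exp β]
  have h : ∀ i, p i * (Real.exp (β * (excess v i - z)) * (Real.exp β - 1)) ≤
      q * Real.exp β / n * Real.exp (β * (excess v i - z)) + 2 / n * Real.exp β := by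
    intro i
    have hw := Real.exp_pos (β * (excess v i - z))
    have he := Real.exp_pos β
    rcases le_or_gt z (excess v i) with hz | hz
    · calc p i * (Real.exp (β * (excess v i - z)) * (Real.exp β - 1))
          ≤ q / n * (Real.exp (β * (excess v i - z)) * Real.exp β) := by
            gcongr
            · exact hhigh i hz
            · linarith
        _ ≤ _ := by
            have : 0 ≤ 2 / (n : ℝ) * Real.exp β := by positivity
            calc _ = q * Real.exp β / n * Real.exp (β * (excess v i - z)) := by ring
              _ ≤ _ := by linarith
    · have hw1 : Real.exp (β * (excess v i - z)) ≤ 1 :=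
        Real.exp_le_one_iff.2 (mul_nonpos_of_nonneg_of_nonpos hβ (by linarith))
      calc p i * (Real.exp (β * (excess v i - z)) * (Real.exp β - 1))
          ≤ 2 / n * (1 * Real.exp β) := by
            gcongr
            · exact hp2 i
            · linarith
        _ ≤ _ := by
            have : 0 ≤ q * Real.exp β / n * Real.exp (β * (excess v i - z)) := by positivity
            linarith
  refine (Finset.sum_le_sum fun i _ => h i).trans ?_
  rw [Finset.sum_add_distrib, ← Finset.mul_sum]
  unfold expPotential
  gcongr
  rcases Nat.eq_zero_or_pos n with rfl | hn
  · simp; positivity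
  · have : (n : ℝ) ≠ 0 := by positivity
    simp
    field_simp
    rfl

theorem exp_neg_mul_one_add_le {n : ℕ} {β q : ℝ} (hn : 0 < n) (hβ : 0 ≤ β) (hβn : β ≤ n)
    (hq : 0 ≤ q) (hqβ : 2 * (q * Real.exp β) ≤ β / 4) :
    Real.exp (-(β / n)) * (1 + 2 * (q * Real.exp β / n)) ≤ 1 - β / (4 * n) := by
  have hn' : (0 : ℝ) < n := by positivity
  have h1 : Real.exp (-(β / n)) ≤ 1 - β / n / 2 :=
    exp_neg_le_one_sub_half (by positivity) ((div_le_one hn').2 hβn)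
  have h2 : 2 * (q * Real.exp β / n) ≤ β / n / 4 := by
    rw [show 2 * (q * Real.exp β / n) = (2 * (q * Real.exp β)) / n by ring,
      show β / n / 4 = β / 4 / n by ring]
    gcongr
  have h3 : 0 ≤ 2 * (q * Real.exp β / n) := by positivity
  have h4 : Real.exp (-(β / n)) ≤ 1 := Real.exp_le_one_iff.2 (by
    have : 0 ≤ β / n := by positivity
    linarith)
  calc Real.exp (-(β / n)) * (1 + 2 * (q * Real.exp β / n))
      = Real.exp (-(β / n)) + Real.exp (-(β / n)) * (2 * (q * Real.exp β / n)) := by ring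
    _ ≤ (1 - β / n / 2) + 1 * (β / n / 4) := by gcongr
    _ = 1 - β / (4 * n) := by field_simp; ring

theorem sum_mul_expPotential_le {n : ℕ} {p : Fin n → ℝ} {v : Fin n → ℕ} {β z q : ℝ} (hn : 0 < n)
    (hp : ∀ i, 0 ≤ p i) (hp1 : ∑ i, p i = 1)
    (hp2 : ∀ i, p i ≤ 2 / n) (hβ : 0 ≤ β) (hβn : β ≤ n) (hq : 0 ≤ q)
    (hqβ : 2 * (q * Real.exp β) ≤ β / 4) (hhigh : ∀ i, z ≤ excess v i → p i ≤ q / n) :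
    ∑ i, p i * expPotential β z (v + Pi.single i 1) ≤
      (1 - β / (4 * n)) * expPotential β z v + 4 * Real.exp β := by
  have hgain := sum_mul_gain_le hp hp2 hβ hq hhigh
  have hΦ := expPotential_nonneg β z v
  have hx : 0 ≤ q * Real.exp β / n := by positivity
  have h4 : Real.exp (-(β / n)) ≤ 1 := Real.exp_le_one_iff.2 (by
    have : 0 ≤ β / n := by positivity
    linarith)
  calc ∑ i, p i * expPotential β z (v + Pi.single i 1)
      = Real.exp (-(β / n)) * ((∑ i, p i) * expPotential β z v +
          ∑ i, p i * (Real.exp (β * (excess v i - z)) * (Real.exp β - 1))) := by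
        rw [Finset.sum_mul, ← Finset.sum_add_distrib, Finset.mul_sum]
        refine Finset.sum_congr rfl fun i _ => ?_
        rw [expPotential_add_single]; ring
    _ ≤ Real.exp (-(β / n)) * (1 * expPotential β z v +
          (2 * (q * Real.exp β / n) * expPotential β z v + 4 * Real.exp β)) := by
        rw [hp1]
        gcongr
        refine hgain.trans ?_
        have := mul_nonneg hx hΦ
        linarith [Real.exp_pos β]
    _ = Real.exp (-(β / n)) * (1 + 2 * (q * Real.exp β / n)) * expPotential β z v +
          Real.exp (-(β / n)) * (4 * Real.exp β) := by ring
    _ ≤ (1 - β / (4 * n)) * expPotential β z v + 1 * (4 * Real.exp β) := by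
        gcongr
        exact exp_neg_mul_one_add_le hn hβ hβn hq hqβ
    _ = _ := by ring

/-- The exponential of a small multiple of the potential has the same drift, provided that no
single bin carries much of the potential. -/
theorem sum_mul_exp_expPotential_le {n : ℕ} {p : Fin n → ℝ} {v : Fin n → ℕ} {β z q lam : ℝ}
    (hn : 0 < n) (hp : ∀ i, 0 ≤ p i) (hp1 : ∑ i, p i = 1)
    (hp2 : ∀ i, p i ≤ 2 / n) (hβ : 0 ≤ β) (hβn : β ≤ n) (hq : 0 ≤ q)
    (hqβ : 2 * (q * Real.exp β) ≤ β / 4) (hhigh : ∀ i, z ≤ excess v i → p i ≤ q / n)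
    (hlam : 0 ≤ lam)
    (hsmall : ∀ i, lam * (Real.exp (β * (excess v i - z)) * Real.exp β) ≤ 1) :
    ∑ i, p i * Real.exp (lam * expPotential β z (v + Pi.single i 1)) ≤
      Real.exp (lam * ((1 - β / (4 * n)) * expPotential β z v + 4 * Real.exp β)) := by
  have hgain := sum_mul_gain_le hp hp2 hβ hq hhigh
  have hΦ := expPotential_nonneg β z v
  have h4 : Real.exp (-(β / n)) ≤ 1 := Real.exp_le_one_iff.2 (by
    have : 0 ≤ β / n := by positivity
    linarith)
  have hβ1 : 0 ≤ Real.exp β - 1 := by linarith [Real.add_one_le_exp β]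
  set E := Real.exp (-(β / n)) with hE
  have hE0 : 0 ≤ E := (Real.exp_pos _).le
  set w := fun i => Real.exp (β * (excess v i - z)) * (Real.exp β - 1) with hw
  have hw0 : ∀ i, 0 ≤ w i := fun i => mul_nonneg (Real.exp_pos _).le hβ1
  have hs1 : ∀ i, lam * E * w i ≤ 1 := by
    intro i
    refine le_trans ?_ (hsmall i)
    calc lam * E * w i ≤ lam * 1 * w i := by
          have := hw0 i
          gcongr
      _ ≤ _ := by
          rw [mul_one]
          simp only [hw]
          gcongr
          linarith
  have hterm : ∀ i, p i * Real.exp (lam * expPotential β z (v + Pi.single i 1)) ≤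
      Real.exp (lam * E * expPotential β z v) * (p i + 2 * (lam * E) * (p i * w i)) := by
    intro i
    rw [expPotential_add_single, ← hE,
      show lam * (E * (expPotential β z v + Real.exp (β * (excess v i - z)) * (Real.exp β - 1))) =
        lam * E * expPotential β z v + lam * E * w i by simp only [hw]; ring, Real.exp_add]
    have := exp_le_one_add_two_mul (mul_nonneg (mul_nonneg hlam hE0) (hw0 i)) (hs1 i)
    calc p i * (Real.exp (lam * E * expPotential β z v) * Real.exp (lam * E * w i))
        ≤ p i * (Real.exp (lam * E * expPotential β z v) * (1 + 2 * (lam * E * w i))) := by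
          have := hp i
          gcongr
      _ = _ := by ring
  refine (Finset.sum_le_sum fun i _ => hterm i).trans ?_
  rw [← Finset.mul_sum, Finset.sum_add_distrib, hp1, ← Finset.mul_sum]
  set X := ∑ i, p i * w i with hX
  calc Real.exp (lam * E * expPotential β z v) * (1 + 2 * (lam * E) * X)
      ≤ Real.exp (lam * E * expPotential β z v) * Real.exp (2 * (lam * E) * X) := by
        gcongr
        linarith [Real.add_one_le_exp (2 * (lam * E) * X)]
    _ = Real.exp (lam * (E * expPotential β z v + E * (2 * X))) := by
        rw [← Real.exp_add]; congr 1; ring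
    _ ≤ _ := by
        refine Real.exp_le_exp.2 (mul_le_mul_of_nonneg_left ?_ hlam)
        calc E * expPotential β z v + E * (2 * X)
            ≤ E * expPotential β z v +
                E * (2 * (q * Real.exp β / n * expPotential β z v + 2 * Real.exp β)) := by gcongr
          _ = E * (1 + 2 * (q * Real.exp β / n)) * expPotential β z v +
                E * (4 * Real.exp β) := by ring
          _ ≤ (1 - β / (4 * n)) * expPotential β z v + 1 * (4 * Real.exp β) := by
              gcongr
              exact exp_neg_mul_one_add_le hn hβ hβn hq hqβ
          _ = _ := by ring

/-! ### The drift inequality for the two-sided potential -/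

/-- If at least `s` bins have excess at most `μ < 0` and at most `s / 4` bins have positive excess,
then the latter carry so much load that the upward potential is at least of order
`s * exp (α * |μ|)`. -/
theorem exp_mul_card_le_of_few_pos {ι : Type*} [Fintype ι] (y : ι → ℝ) {α μ s : ℝ} (hα : 0 < α)
    (hμ : μ ≤ 0) (hs0 : 0 ≤ s) (hsN : s ≤ Fintype.card ι)
    (hcase : ((Finset.univ.filter fun i => 0 < y i).card : ℝ) < s / 4)
    (hPy : -(s * μ) ≤ ∑ i ∈ Finset.univ.filter fun i => 0 < y i, y i) :
    Real.exp (-(α * μ)) * s ≤ 2 * ∑ i, Real.exp (α * y i) + 3 * Fintype.card ι := by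
  set N : ℝ := (Fintype.card ι : ℝ) with hN
  set M := Real.exp (-(α * μ)) with hM
  set P := Finset.univ.filter fun i => 0 < y i with hP
  set r : ℝ := (P.card : ℝ) with hr
  set Φ := ∑ i, Real.exp (α * y i) with hΦ
  have hM1 : 1 ≤ M := Real.one_le_exp (by nlinarith)
  have hΦ0 : 0 ≤ Φ := Finset.sum_nonneg fun _ _ => (Real.exp_pos _).le
  rcases le_or_gt (-(α * μ)) 1 with hm | hm
  · have : M ≤ 3 := by
      have := Real.exp_le_exp.2 hm
      linarith [Real.exp_one_lt_d9]
    nlinarith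
  · -- the tangent of the exponential at twice the threshold `-μ`
    have q4 : M ^ 2 * (α * (∑ i ∈ P, y i + 2 * μ * r)) ≤ Φ := by
      calc M ^ 2 * (α * (∑ i ∈ P, y i + 2 * μ * r))
          = ∑ i ∈ P, M ^ 2 * (α * (y i + 2 * μ)) := by
            rw [← Finset.mul_sum, ← Finset.mul_sum, Finset.sum_add_distrib]
            simp only [Finset.sum_const, nsmul_eq_mul, hr]
            ring
        _ ≤ ∑ i ∈ P, Real.exp (α * y i) := by
            refine Finset.sum_le_sum fun i _ => ?_
            have hexp : Real.exp (α * y i) = M ^ 2 * Real.exp (α * (y i + 2 * μ)) := by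
              rw [hM, ← Real.exp_nat_mul, ← Real.exp_add]
              congr 1; push_cast; ring
            rw [hexp]
            have := Real.add_one_le_exp (α * (y i + 2 * μ))
            exact mul_le_mul_of_nonneg_left (by linarith) (by positivity)
        _ ≤ Φ := Finset.sum_le_sum_of_subset_of_nonneg (Finset.subset_univ _)
            fun _ _ _ => (Real.exp_pos _).le
    have q5 : s / 2 ≤ α * (∑ i ∈ P, y i + 2 * μ * r) := by
      have q6 : -(s * μ) / 2 ≤ ∑ i ∈ P, y i + 2 * μ * r := by nlinarith
      have q7 := mul_le_mul_of_nonneg_left q6 hα.le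
      nlinarith
    have q8 : M * (s / 2) ≤ M ^ 2 * (α * (∑ i ∈ P, y i + 2 * μ * r)) := by
      have : M ≤ M ^ 2 := by nlinarith
      gcongr
    have : 0 ≤ N := by linarith
    linarith

/-- The drift inequality behind the two-sided potential, for a threshold `μ ≤ 0` separating the
bins `T` that lose load relative to the average from the others, which gain. Only the term
`∑ i ∈ T, a i * exp (-α * y i)` is dangerous. Either a constant proportion of the bins has positive
excess, and then these bins contribute nothing to it, or few bins carry all the positive excess, and
then `∑ i, exp (α * y i)` is large by convexity. -/
theorem two_sided_drift_of_nonpos {ι : Type*} [Fintype ι] [DecidableEq ι] (T : Finset ι)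
    (a y : ι → ℝ) {α μ : ℝ} (hα : 0 < α) (hμ : μ ≤ 0) (ha : ∀ i, 1 / 4 ≤ a i) (ha1 : ∀ i, a i ≤ 1)
    (haT : ∑ i ∈ T, a i = ∑ i ∈ Tᶜ, a i) (hT : ∀ i ∈ T, μ ≤ y i) (hS : ∀ i ∈ Tᶜ, y i ≤ μ)
    (hy : ∑ i, y i = 0) :
    ∑ i ∈ Tᶜ, a i * Real.exp (α * y i) - ∑ i ∈ T, a i * Real.exp (α * y i) +
      (∑ i ∈ T, a i * Real.exp (-α * y i) - ∑ i ∈ Tᶜ, a i * Real.exp (-α * y i)) ≤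
      5 * Fintype.card ι - 1 / 128 *
        (∑ i, Real.exp (α * y i) + ∑ i, Real.exp (-α * y i)) := by
  set N : ℝ := (Fintype.card ι : ℝ) with hN
  set M := Real.exp (-(α * μ)) with hM
  set P := T.filter fun i => 0 < y i with hP
  set s : ℝ := (Tᶜ.card : ℝ) with hs
  set r : ℝ := (P.card : ℝ) with hr
  have hM0 : 0 < M := Real.exp_pos _
  have hM1 : 1 ≤ M := Real.one_le_exp (by nlinarith)
  have hsN : s ≤ N := by rw [hs, hN]; exact_mod_cast Finset.card_le_univ _
  have hTN : (T.card : ℝ) ≤ N := by rw [hN]; exact_mod_cast Finset.card_le_univ _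
  have hs0 : 0 ≤ s := by rw [hs]; positivity
  have huT : ∀ i ∈ T, Real.exp (-α * y i) ≤ M := fun i hi =>
    Real.exp_le_exp.2 (by nlinarith [hT i hi])
  have huS : ∀ i ∈ Tᶜ, M ≤ Real.exp (-α * y i) := fun i hi =>
    Real.exp_le_exp.2 (by nlinarith [hS i hi])
  have hwS : ∀ i ∈ Tᶜ, Real.exp (α * y i) ≤ 1 := fun i hi =>
    Real.exp_le_one_iff.2 (by nlinarith [hS i hi])
  have hsplit : ∀ f : ι → ℝ, ∑ i, f i = ∑ i ∈ T, f i + ∑ i ∈ Tᶜ, f i := fun f =>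
    (Finset.sum_add_sum_compl T f).symm
  set Φ := ∑ i, Real.exp (α * y i) with hΦ
  set AS := ∑ i ∈ Tᶜ, a i * Real.exp (-α * y i) with hAS
  set AT := ∑ i ∈ T, a i * Real.exp (-α * y i) with hAT
  have hΦ0 : 0 ≤ Φ := Finset.sum_nonneg fun _ _ => (Real.exp_pos _).le
  -- the upward potential
  have h1 : ∑ i ∈ Tᶜ, a i * Real.exp (α * y i) ≤ N := by
    calc ∑ i ∈ Tᶜ, a i * Real.exp (α * y i) ≤ ∑ i ∈ Tᶜ, (1 : ℝ) :=
          Finset.sum_le_sum fun i hi =>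
            mul_le_one₀ (ha1 i) (Real.exp_pos _).le (hwS i hi)
      _ = s := by simp [hs]
      _ ≤ N := hsN
  have h2 : ∑ i ∈ Tᶜ, Real.exp (α * y i) ≤ N := by
    calc ∑ i ∈ Tᶜ, Real.exp (α * y i) ≤ ∑ i ∈ Tᶜ, (1 : ℝ) := Finset.sum_le_sum hwS
      _ = s := by simp [hs]
      _ ≤ N := hsN
  have h3 : 1 / 4 * (Φ - N) ≤ ∑ i ∈ T, a i * Real.exp (α * y i) := by
    have := hsplit fun i => Real.exp (α * y i)
    calc 1 / 4 * (Φ - N) ≤ 1 / 4 * ∑ i ∈ T, Real.exp (α * y i) := by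
          rw [hΦ, this]; linarith
      _ = ∑ i ∈ T, 1 / 4 * Real.exp (α * y i) := Finset.mul_sum _ _ _
      _ ≤ _ := Finset.sum_le_sum fun i _ =>
          mul_le_mul_of_nonneg_right (ha i) (Real.exp_pos _).le
  -- the downward potential is controlled by `AS`
  have hASM : M * ∑ i ∈ Tᶜ, a i ≤ AS := by
    rw [Finset.mul_sum]
    exact Finset.sum_le_sum fun i hi => by
      rw [mul_comm]
      exact mul_le_mul_of_nonneg_left (huS i hi) (by linarith [ha i])
  have hATM : AT ≤ M * ∑ i ∈ T, a i := by
    rw [Finset.mul_sum]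
    exact Finset.sum_le_sum fun i hi => by
      rw [mul_comm M]
      exact mul_le_mul_of_nonneg_left (huT i hi) (by linarith [ha i])
  have haS : ∑ i ∈ Tᶜ, a i ≤ s := by
    calc ∑ i ∈ Tᶜ, a i ≤ ∑ i ∈ Tᶜ, (1 : ℝ) := Finset.sum_le_sum fun i _ => ha1 i
      _ = s := by simp [hs]
  have hΨ : ∑ i, Real.exp (-α * y i) ≤ 8 * AS := by
    rw [hsplit]
    have e1 : ∑ i ∈ Tᶜ, Real.exp (-α * y i) ≤ 4 * AS := by
      rw [hAS, Finset.mul_sum]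
      exact Finset.sum_le_sum fun i _ => by nlinarith [ha i, Real.exp_pos (-α * y i)]
    have e2 : ∑ i ∈ T, Real.exp (-α * y i) ≤ 4 * AS := by
      calc ∑ i ∈ T, Real.exp (-α * y i) ≤ ∑ i ∈ T, 4 * (M * a i) :=
            Finset.sum_le_sum fun i hi => by nlinarith [ha i, huT i hi]
        _ = 4 * (M * ∑ i ∈ T, a i) := by rw [← Finset.mul_sum, ← Finset.mul_sum]
        _ ≤ 4 * AS := by rw [haT]; linarith
    linarith
  have hkey : AT ≤ 15 / 16 * AS + 1 / 8 * Φ + N := by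
    rcases le_or_gt (s / 4) r with hcase | hcase
    · -- bins of positive excess contribute at most `1` to `AT`, instead of `a i * M`
      have e1 : AT ≤ M * ∑ i ∈ T, a i - M / 4 * r + N := by
        calc AT ≤ ∑ i ∈ T, (M * a i - (if 0 < y i then M / 4 else 0) + 1) := by
              refine Finset.sum_le_sum fun i hi => ?_
              split_ifs with h
              · have : Real.exp (-α * y i) ≤ 1 := Real.exp_le_one_iff.2 (by nlinarith)
                have e : a i * Real.exp (-α * y i) ≤ 1 :=
                  mul_le_one₀ (ha1 i) (Real.exp_pos _).le this
                nlinarith [ha i]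
              · have := mul_le_mul_of_nonneg_left (huT i hi) (by linarith [ha i] : 0 ≤ a i)
                linarith
          _ = M * ∑ i ∈ T, a i - M / 4 * r + T.card := by
              rw [Finset.sum_add_distrib, Finset.sum_sub_distrib, ← Finset.mul_sum,
                ← Finset.sum_filter]
              simp only [Finset.sum_const, nsmul_eq_mul, mul_one, hr, hP]
              ring
          _ ≤ _ := by linarith
      have e2 : M / 4 * r ≥ M / 16 * ∑ i ∈ Tᶜ, a i := by nlinarith
      rw [haT] at e1
      linarith
    · -- the positive bins balance the `s` bins of excess at most `μ`
      have hPy : -(s * μ) ≤ ∑ i ∈ P, y i := by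
        have q1 := hsplit y
        have q2 : ∑ i ∈ Tᶜ, y i ≤ s * μ := by
          calc ∑ i ∈ Tᶜ, y i ≤ ∑ i ∈ Tᶜ, μ := Finset.sum_le_sum hS
            _ = s * μ := by simp [hs]
        have q3 : ∑ i ∈ T, y i ≤ ∑ i ∈ P, y i := by
          rw [hP, Finset.sum_filter]
          refine Finset.sum_le_sum fun i _ => ?_
          split_ifs with h
          · exact le_rfl
          · exact not_lt.1 h
        rw [hy] at q1
        linarith
      have hPT : P = Finset.univ.filter fun i => 0 < y i := by
        ext i
        simp only [hP, Finset.mem_filter, Finset.mem_univ, true_and, and_iff_right_iff_imp]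
        intro hi
        by_contra hiT
        linarith [hS i (Finset.mem_compl.2 hiT)]
      have e1 : M * s ≤ 2 * Φ + 3 * N :=
        exp_mul_card_le_of_few_pos y hα hμ hs0 hsN (by rw [← hPT]; exact hcase)
          (by rw [← hPT]; exact hPy)
      have e2 : M * ∑ i ∈ T, a i ≤ M * s := by
        rw [haT]; gcongr
      rw [haT] at hATM e2
      linarith
  linarith

theorem two_sided_drift {ι : Type*} [Fintype ι] [DecidableEq ι] (T : Finset ι)
    (a y : ι → ℝ) {α μ : ℝ} (hα : 0 < α) (ha : ∀ i, 1 / 4 ≤ a i) (ha1 : ∀ i, a i ≤ 1)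
    (haT : ∑ i ∈ T, a i = ∑ i ∈ Tᶜ, a i) (hT : ∀ i ∈ T, μ ≤ y i) (hS : ∀ i ∈ Tᶜ, y i ≤ μ)
    (hy : ∑ i, y i = 0) :
    ∑ i ∈ Tᶜ, a i * Real.exp (α * y i) - ∑ i ∈ T, a i * Real.exp (α * y i) +
      (∑ i ∈ T, a i * Real.exp (-α * y i) - ∑ i ∈ Tᶜ, a i * Real.exp (-α * y i)) ≤
      5 * Fintype.card ι - 1 / 128 *
        (∑ i, Real.exp (α * y i) + ∑ i, Real.exp (-α * y i)) := by
  rcases le_total μ 0 with hμ | hμ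
  · exact two_sided_drift_of_nonpos T a y hα hμ ha ha1 haT hT hS hy
  · -- reflect `y` and exchange the roles of `T` and its complement
    have h := two_sided_drift_of_nonpos Tᶜ a (fun i => -y i) (μ := -μ) hα (by linarith) ha ha1
      (by rw [compl_compl]; exact haT.symm) (fun i hi => neg_le_neg (hS i hi))
      (fun i hi => neg_le_neg (hT i (by rwa [compl_compl] at hi)))
      (by rw [Finset.sum_neg_distrib, hy, neg_zero])
    simp only [compl_compl, mul_neg, neg_mul, neg_neg] at h ⊢
    linarith


/-! ### Expected change of the two-sided potential -/

section TwoSided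

variable {n : ℕ} {p : Fin n → ℝ} {v : Fin n → ℕ} {α : ℝ} {T : Finset (Fin n)}

/-- The first order part of the expected change of the two-sided potential. -/
theorem sum_bias_le (hn : 0 < n) (hp1 : ∑ i, p i = 1) (hp2 : ∀ i, p i ≤ 2 / n) (hp : ∀ i, 0 ≤ p i)
    (hT0 : T.Nonempty) (hT : ∀ i ∈ T, p i ≤ 3 / 4 / n) (hS : ∀ i, i ∉ T → 5 / 4 / n ≤ p i)
    (hord : ∀ i ∈ T, ∀ j, j ∉ T → excess v j ≤ excess v i) (hα : 0 < α) :
    (n * ∑ i, p i * Real.exp (α * (excess v i - 0)) - expPotential α 0 v) -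
      (n * ∑ i, p i * Real.exp (-α * (excess v i - 0)) - expPotential (-α) 0 v) ≤
      5 * n - 1 / 128 * coshPotential α v := by
  have hn' : (0 : ℝ) < n := by positivity
  obtain ⟨i₀, hi₀, hmin⟩ := T.exists_min_image (excess v) hT0
  have hpT : ∀ i ∈ T, n * p i ≤ 3 / 4 := fun i hi => by
    have := hT i hi
    rwa [le_div_iff₀ hn', mul_comm] at this
  have hpS : ∀ i ∈ Tᶜ, 5 / 4 ≤ n * p i := fun i hi => by
    have := hS i (Finset.mem_compl.1 hi)
    rwa [div_le_iff₀ hn', mul_comm] at this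
  have hpn : ∀ i, n * p i ≤ 2 := fun i => by
    have := hp2 i
    rwa [le_div_iff₀ hn', mul_comm] at this
  have hpn0 : ∀ i, 0 ≤ n * p i := fun i => mul_nonneg hn'.le (hp i)
  have haT : ∀ i ∈ T, |n * p i - 1| = 1 - n * p i := fun i hi => by
    rw [abs_of_nonpos (by linarith [hpT i hi])]; ring
  have haS : ∀ i ∈ Tᶜ, |n * p i - 1| = n * p i - 1 := fun i hi =>
    abs_of_nonneg (by linarith [hpS i hi])
  have hsplit : ∀ f : Fin n → ℝ, ∑ i, f i = ∑ i ∈ T, f i + ∑ i ∈ Tᶜ, f i := fun f =>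
    (Finset.sum_add_sum_compl T f).symm
  have hbias : ∀ f : Fin n → ℝ, n * ∑ i, p i * f i - ∑ i, f i =
      ∑ i ∈ Tᶜ, |n * p i - 1| * f i - ∑ i ∈ T, |n * p i - 1| * f i := by
    intro f
    have e1 : ∑ i ∈ Tᶜ, |n * p i - 1| * f i = ∑ i ∈ Tᶜ, (n * p i - 1) * f i :=
      Finset.sum_congr rfl fun i hi => by rw [haS i hi]
    have e2 : ∑ i ∈ T, |n * p i - 1| * f i = -∑ i ∈ T, (n * p i - 1) * f i := by
      rw [← Finset.sum_neg_distrib]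
      exact Finset.sum_congr rfl fun i hi => by rw [haT i hi]; ring
    have e3 : n * ∑ i, p i * f i - ∑ i, f i = ∑ i, (n * p i - 1) * f i := by
      rw [Finset.mul_sum, ← Finset.sum_sub_distrib]
      exact Finset.sum_congr rfl fun i _ => by ring
    rw [e1, e2, e3, hsplit]
    ring
  have hbal : ∑ i ∈ T, |n * p i - 1| = ∑ i ∈ Tᶜ, |n * p i - 1| := by
    have := hbias fun _ => 1
    simp only [mul_one, hp1] at this
    simp at this
    linarith
  have h := two_sided_drift T (fun i => |n * p i - 1|) (excess v) (μ := excess v i₀) hα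
    (fun i => by
      by_cases hi : i ∈ T
      · rw [haT i hi]; linarith [hpT i hi]
      · rw [haS i (Finset.mem_compl.2 hi)]; linarith [hpS i (Finset.mem_compl.2 hi)])
    (fun i => abs_le.2 ⟨by linarith [hpn0 i], by linarith [hpn i]⟩) hbal hmin
    (fun j hj => hord i₀ hi₀ j (Finset.mem_compl.1 hj)) (sum_excess v)
  unfold coshPotential expPotential
  rw [hbias, hbias]
  simp only [sub_zero]
  rw [Fintype.card_fin] at h
  linarith

theorem sum_mul_le_of_le_two_div {f : Fin n → ℝ} (hp2 : ∀ i, p i ≤ 2 / n) (hf : ∀ i, 0 ≤ f i) :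
    ∑ i, p i * f i ≤ 2 / n * ∑ i, f i := by
  rw [Finset.mul_sum]
  exact Finset.sum_le_sum fun i _ => mul_le_mul_of_nonneg_right (hp2 i) (hf i)

theorem sum_mul_expPotential_eq (hp1 : ∑ i, p i = 1) (β z : ℝ) :
    ∑ i, p i * expPotential β z (v + Pi.single i 1) = Real.exp (-(β / n)) *
      (expPotential β z v +
        (∑ i, p i * Real.exp (β * (excess v i - z))) * (Real.exp β - 1)) := by
  calc ∑ i, p i * expPotential β z (v + Pi.single i 1)
      = Real.exp (-(β / n)) * ((∑ i, p i) * expPotential β z v +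
          (∑ i, p i * Real.exp (β * (excess v i - z))) * (Real.exp β - 1)) := by
        rw [Finset.sum_mul, Finset.sum_mul, ← Finset.sum_add_distrib, Finset.mul_sum]
        refine Finset.sum_congr rfl fun i _ => ?_
        rw [expPotential_add_single]; ring
    _ = _ := by rw [hp1, one_mul]

theorem exp_le_quadratic {x : ℝ} (h : |x| ≤ 1) : Real.exp x ≤ 1 + x + x ^ 2 := by
  linarith [(abs_le.1 (Real.abs_exp_sub_one_sub_id_le h)).2]

/-- If the bins in `T`, which have the largest loads, are chosen less often than the average bin and
the others more often, then the two-sided potential has a drift towards order `n`. -/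
theorem sum_mul_coshPotential_le (hn : 0 < n) (hp1 : ∑ i, p i = 1) (hp2 : ∀ i, p i ≤ 2 / n)
    (hp : ∀ i, 0 ≤ p i)
    (hT0 : T.Nonempty) (hT : ∀ i ∈ T, p i ≤ 3 / 4 / n) (hS : ∀ i, i ∉ T → 5 / 4 / n ≤ p i)
    (hord : ∀ i ∈ T, ∀ j, j ∉ T → excess v j ≤ excess v i) (hα : 0 < α) (hα1 : α ≤ 1 / 1000) :
    ∑ i, p i * coshPotential α (v + Pi.single i 1) ≤
      (1 - α / (256 * n)) * coshPotential α v + 5 * α := by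
  have hn' : (0 : ℝ) < n := by positivity
  have hn1 : (1 : ℝ) ≤ n := by exact_mod_cast hn
  have hbias := sum_bias_le hn hp1 hp2 hp hT0 hT hS hord hα
  have hW2 := sum_mul_le_of_le_two_div (f := fun i => Real.exp (α * (excess v i - 0))) hp2
    fun i => (Real.exp_pos _).le
  have hU2 := sum_mul_le_of_le_two_div (f := fun i => Real.exp (-α * (excess v i - 0))) hp2
    fun i => (Real.exp_pos _).le
  have hW0 : 0 ≤ ∑ i, p i * Real.exp (α * (excess v i - 0)) :=
    Finset.sum_nonneg fun i _ => mul_nonneg (hp i) (Real.exp_pos _).le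
  have hU0 : 0 ≤ ∑ i, p i * Real.exp (-α * (excess v i - 0)) :=
    Finset.sum_nonneg fun i _ => mul_nonneg (hp i) (Real.exp_pos _).le
  have e1 := sum_mul_expPotential_eq (v := v) hp1 α 0
  have e2 := sum_mul_expPotential_eq (v := v) hp1 (-α) 0
  have e3 : ∑ i, p i * coshPotential α (v + Pi.single i 1) =
      ∑ i, p i * expPotential α 0 (v + Pi.single i 1) +
      ∑ i, p i * expPotential (-α) 0 (v + Pi.single i 1) := by
    rw [← Finset.sum_add_distrib]
    exact Finset.sum_congr rfl fun i _ => by unfold coshPotential; ring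
  rw [e3, e1, e2]
  have hΦ0 := expPotential_nonneg α 0 v
  have hΨ0 := expPotential_nonneg (-α) 0 v
  unfold coshPotential at hbias ⊢
  change _ ≤ 2 / n * expPotential α 0 v at hW2
  change _ ≤ 2 / n * expPotential (-α) 0 v at hU2
  set Φ := expPotential α 0 v
  set Ψ := expPotential (-α) 0 v
  set W := ∑ i, p i * Real.exp (α * (excess v i - 0))
  set U := ∑ i, p i * Real.exp (-α * (excess v i - 0))
  set x := α / n with hx
  have hx0 : 0 < x := by positivity
  have hxα : x ≤ α := div_le_self hα.le hn1
  have hxn : x * n = α := by rw [hx]; field_simp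
  have a1 : Real.exp (-x) ≤ 1 - x + x ^ 2 := by
    have := exp_le_quadratic (x := -x) (by rw [abs_neg, abs_of_pos hx0]; linarith)
    linarith [neg_sq x]
  have a2 : Real.exp x ≤ 1 + x + x ^ 2 := exp_le_quadratic (by rw [abs_of_pos hx0]; linarith)
  have a3 : Real.exp α - 1 ≤ α + α ^ 2 := by
    linarith [exp_le_quadratic (x := α) (by rw [abs_of_pos hα]; linarith)]
  have a4 : α - α ^ 2 ≤ 1 - Real.exp (-α) := by
    have := exp_le_quadratic (x := -α) (by rw [abs_neg, abs_of_pos hα]; linarith)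
    linarith [neg_sq α]
  have a5 : 0 ≤ α - α ^ 2 := by nlinarith
  have b1 : Real.exp (-x) * (Φ + W * (Real.exp α - 1)) ≤ (1 - x + x ^ 2) * Φ + W * (α + α ^ 2) := by
    have h1 : Real.exp (-x) ≤ 1 := Real.exp_le_one_iff.2 (by linarith)
    have h2 : 0 ≤ Real.exp α - 1 := by linarith [Real.add_one_le_exp α]
    calc Real.exp (-x) * (Φ + W * (Real.exp α - 1))
        = Real.exp (-x) * Φ + Real.exp (-x) * (W * (Real.exp α - 1)) := by ring
      _ ≤ (1 - x + x ^ 2) * Φ + 1 * (W * (α + α ^ 2)) := by gcongr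
      _ = _ := by ring
  have b2 : Real.exp (-(-α / n)) * (Ψ + U * (Real.exp (-α) - 1)) ≤
      (1 + x + x ^ 2) * Ψ - U * (α - α ^ 2) := by
    have h1 : 1 ≤ Real.exp x := Real.one_le_exp hx0.le
    rw [show -(-α / (n : ℝ)) = x by rw [hx]; ring]
    have h2 : 1 * (U * (α - α ^ 2)) ≤ Real.exp x * (U * (1 - Real.exp (-α))) := by gcongr
    have h3 : Real.exp x * Ψ ≤ (1 + x + x ^ 2) * Ψ := by gcongr
    linarith [h2, h3]
  have c1 : x * (n * W - Φ) - x * (n * U - Ψ) ≤ x * (5 * n - 1 / 128 * (Φ + Ψ)) := by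
    have := mul_le_mul_of_nonneg_left hbias hx0.le
    linarith
  have c2 : α ^ 2 * (W + U) ≤ 2 * α * x * (Φ + Ψ) := by
    calc α ^ 2 * (W + U) ≤ α ^ 2 * (2 / n * Φ + 2 / n * Ψ) := by gcongr
      _ = 2 * α * x * (Φ + Ψ) := by rw [hx]; field_simp
  have c3 : x ^ 2 * (Φ + Ψ) ≤ α * x * (Φ + Ψ) := by
    have : x ^ 2 ≤ α * x := by nlinarith
    gcongr
  have c4 : 3 * α * x * (Φ + Ψ) ≤ x * (1 / 256 * (Φ + Ψ)) := by
    have : 3 * α ≤ 1 / 256 := by linarith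
    calc 3 * α * x * (Φ + Ψ) ≤ 1 / 256 * x * (Φ + Ψ) := by gcongr
      _ = _ := by ring
  have c5 : (1 - α / (256 * n)) * (Φ + Ψ) = (Φ + Ψ) - x * (1 / 256 * (Φ + Ψ)) := by
    rw [hx]; field_simp
  have c6 : x * (n * W - Φ) - x * (n * U - Ψ) = α * W - α * U - x * Φ + x * Ψ := by
    rw [← hxn]; ring
  rw [c5]
  have c7 : x * (5 * n - 1 / 128 * (Φ + Ψ)) = 5 * α - 2 * (x * (1 / 256 * (Φ + Ψ))) := by
    rw [← hxn]; ring
  linarith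

theorem abs_coshPotential_add_single_sub_le (hα : 0 < α) (hα1 : α ≤ 1 / 1000) (v : Fin n → ℕ)
    (i : Fin n) :
    |coshPotential α (v + Pi.single i 1) - coshPotential α v| ≤ 2 * (α / n) * coshPotential α v +
      2 * α * (Real.exp (α * excess v i) + Real.exp (-α * excess v i)) := by
  have hn : 0 < n := i.pos
  have hn' : (0 : ℝ) < n := by positivity
  have hn1 : (1 : ℝ) ≤ n := by exact_mod_cast hn
  have hΦ0 := expPotential_nonneg α 0 v
  have hΨ0 := expPotential_nonneg (-α) 0 v
  unfold coshPotential
  rw [expPotential_add_single, expPotential_add_single]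
  simp only [sub_zero]
  set Φ := expPotential α 0 v
  set Ψ := expPotential (-α) 0 v
  set w := Real.exp (α * excess v i)
  set u := Real.exp (-α * excess v i)
  have hw : 0 < w := Real.exp_pos _
  have hu : 0 < u := Real.exp_pos _
  set x := α / n with hx
  rw [show -(-α / (n : ℝ)) = x by rw [hx]; ring]
  have hx0 : 0 < x := by positivity
  have hxα : x ≤ α := div_le_self hα.le hn1
  have a1 : 1 - x ≤ Real.exp (-x) := by linarith [Real.add_one_le_exp (-x)]
  have a1' : Real.exp (-x) ≤ 1 := Real.exp_le_one_iff.2 (by linarith)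
  have a2 : Real.exp x ≤ 1 + 2 * x := exp_le_one_add_two_mul hx0.le (by linarith)
  have a2' : 1 ≤ Real.exp x := Real.one_le_exp hx0.le
  have a3 : Real.exp α - 1 ≤ 2 * α := by
    linarith [exp_le_one_add_two_mul hα.le (by linarith)]
  have a3' : 0 ≤ Real.exp α - 1 := by linarith [Real.add_one_le_exp α]
  have a4 : 1 - Real.exp (-α) ≤ α := by linarith [Real.add_one_le_exp (-α)]
  have a4' : 0 ≤ 1 - Real.exp (-α) := by
    linarith [Real.exp_le_one_iff.2 (by linarith : -α ≤ 0)]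
  have b1 : Real.exp (-x) * (w * (Real.exp α - 1)) ≤ 2 * α * w := by
    calc Real.exp (-x) * (w * (Real.exp α - 1)) ≤ 1 * (w * (2 * α)) := by gcongr
      _ = _ := by ring
  have b1' : 0 ≤ Real.exp (-x) * (w * (Real.exp α - 1)) := by positivity
  have b2 : Real.exp x * (u * (1 - Real.exp (-α))) ≤ 2 * α * u := by
    calc Real.exp x * (u * (1 - Real.exp (-α))) ≤ 2 * (u * α) := by
          gcongr
          linarith
      _ = _ := by ring
  have b2' : 0 ≤ Real.exp x * (u * (1 - Real.exp (-α))) := by positivity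
  have b3 : Real.exp (-x) * Φ ≤ 1 * Φ := by gcongr
  have b3' : (1 - x) * Φ ≤ Real.exp (-x) * Φ := by gcongr
  have b4 : Real.exp x * Ψ ≤ (1 + 2 * x) * Ψ := by gcongr
  have b4' : 1 * Ψ ≤ Real.exp x * Ψ := by gcongr
  have b5 : 0 ≤ x * Φ := by positivity
  have b6 : 0 ≤ x * Ψ := by positivity
  have b7 : 0 ≤ α * w := by positivity
  have b8 : 0 ≤ α * u := by positivity
  rw [abs_le]
  constructor <;> linarith

/-- The exponential of a small multiple of the two-sided potential has a drift as well, provided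
that no single bin carries much of the potential. -/
theorem sum_mul_exp_coshPotential_le (hn : 0 < n) (hp1 : ∑ i, p i = 1) (hp2 : ∀ i, p i ≤ 2 / n)
    (hp : ∀ i, 0 ≤ p i)
    (hT0 : T.Nonempty) (hT : ∀ i ∈ T, p i ≤ 3 / 4 / n) (hS : ∀ i, i ∉ T → 5 / 4 / n ≤ p i)
    (hord : ∀ i ∈ T, ∀ j, j ∉ T → excess v j ≤ excess v i) (hα : 0 < α) (hα1 : α ≤ 1 / 1000)
    {lam ρ : ℝ} (hlam : 0 ≤ lam)
    (hρ : ∀ i, Real.exp (α * excess v i) + Real.exp (-α * excess v i) ≤ ρ)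
    (hlρ : lam * ρ ≤ 1 / 100) :
    ∑ i, p i * Real.exp (lam * coshPotential α (v + Pi.single i 1)) ≤
      Real.exp (lam * ((1 - α / (512 * n)) * coshPotential α v + 5 * α)) := by
  have hn' : (0 : ℝ) < n := by positivity
  have hdrift := sum_mul_coshPotential_le hn hp1 hp2 hp hT0 hT hS hord hα hα1
  set V := coshPotential α v with hV
  have hV0 : 0 ≤ V := coshPotential_nonneg _ _
  set Δ := fun i => coshPotential α (v + Pi.single i 1) - V with hΔ
  set G := fun i => Real.exp (α * excess v i) + Real.exp (-α * excess v i) with hG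
  have hG0 : ∀ i, 0 ≤ G i := fun i => by positivity
  have hVG : V = ∑ i, G i := by
    simp only [hV, hG, coshPotential, expPotential, sub_zero, Finset.sum_add_distrib]
  have hVρ : V ≤ n * ρ := by
    rw [hVG]
    calc ∑ i, G i ≤ ∑ _i : Fin n, ρ := Finset.sum_le_sum fun i _ => hρ i
      _ = n * ρ := by simp
  have hρ0 : 0 ≤ ρ := by
    by_contra h
    nlinarith
  have habs : ∀ i, |Δ i| ≤ 2 * (α / n) * V + 2 * α * G i := fun i =>
    abs_coshPotential_add_single_sub_le hα hα1 v i
  have hmax : ∀ i, |Δ i| ≤ 4 * α * ρ := fun i => by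
    calc |Δ i| ≤ 2 * (α / n) * V + 2 * α * G i := habs i
      _ ≤ 2 * (α / n) * (n * ρ) + 2 * α * ρ := by
          have := hρ i
          gcongr
      _ = 4 * α * ρ := by field_simp; ring
  have hmean : ∑ i, p i * |Δ i| ≤ 6 * (α / n) * V := by
    calc ∑ i, p i * |Δ i| ≤ ∑ i, p i * (2 * (α / n) * V + 2 * α * G i) :=
          Finset.sum_le_sum fun i _ => mul_le_mul_of_nonneg_left (habs i) (hp i)
      _ = (∑ i, p i) * (2 * (α / n) * V) + 2 * α * ∑ i, p i * G i := by
          rw [Finset.sum_mul, Finset.mul_sum, ← Finset.sum_add_distrib]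
          exact Finset.sum_congr rfl fun i _ => by ring
      _ ≤ 1 * (2 * (α / n) * V) + 2 * α * (2 / n * V) := by
          rw [hp1, hVG]
          gcongr
          exact sum_mul_le_of_le_two_div hp2 hG0
      _ = 6 * (α / n) * V := by field_simp; ring
  have hterm : ∀ i, p i * Real.exp (lam * coshPotential α (v + Pi.single i 1)) ≤
      Real.exp (lam * V) *
        (p i + lam * (p i * Δ i) + lam * (4 * α * (lam * ρ)) * (p i * |Δ i|)) := by
    intro i
    have hl : |lam * Δ i| ≤ 1 := by
      rw [abs_mul, abs_of_nonneg hlam]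
      calc lam * |Δ i| ≤ lam * (4 * α * ρ) := by gcongr; exact hmax i
        _ = 4 * α * (lam * ρ) := by ring
        _ ≤ 4 * (1 / 1000) * (1 / 100) := by gcongr
        _ ≤ 1 := by norm_num
    have hq : (lam * Δ i) ^ 2 ≤ lam * (4 * α * (lam * ρ)) * |Δ i| := by
      rw [mul_pow, ← sq_abs (Δ i)]
      calc lam ^ 2 * |Δ i| ^ 2 = lam ^ 2 * |Δ i| * |Δ i| := by ring
        _ ≤ lam ^ 2 * (4 * α * ρ) * |Δ i| := by gcongr; exact hmax i
        _ = _ := by ring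
    have he := exp_le_quadratic hl
    rw [show lam * coshPotential α (v + Pi.single i 1) = lam * V + lam * Δ i by
      simp only [hΔ]; ring, Real.exp_add]
    calc p i * (Real.exp (lam * V) * Real.exp (lam * Δ i))
        ≤ p i * (Real.exp (lam * V) *
            (1 + lam * Δ i + lam * (4 * α * (lam * ρ)) * |Δ i|)) := by
          have := hp i
          gcongr
          linarith
      _ = _ := by ring
  refine (Finset.sum_le_sum fun i _ => hterm i).trans ?_
  rw [← Finset.mul_sum, Finset.sum_add_distrib, Finset.sum_add_distrib, hp1, ← Finset.mul_sum,
    ← Finset.mul_sum]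
  have hΔmean : ∑ i, p i * Δ i ≤ -(α / (256 * n)) * V + 5 * α := by
    have : ∑ i, p i * Δ i = ∑ i, p i * coshPotential α (v + Pi.single i 1) - (∑ i, p i) * V := by
      rw [Finset.sum_mul, ← Finset.sum_sub_distrib]
      exact Finset.sum_congr rfl fun i _ => by simp only [hΔ]; ring
    rw [this, hp1]
    linarith
  have hsecond : 4 * α * (lam * ρ) * ∑ i, p i * |Δ i| ≤ α / (512 * n) * V := by
    calc 4 * α * (lam * ρ) * ∑ i, p i * |Δ i|
        ≤ 4 * (1 / 1000) * (1 / 100) * (6 * (α / n) * V) := by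
          have : 0 ≤ ∑ i, p i * |Δ i| :=
            Finset.sum_nonneg fun i _ => mul_nonneg (hp i) (abs_nonneg _)
          gcongr
      _ = 24 / 100000 * (α / n * V) := by ring
      _ ≤ 1 / 512 * (α / n * V) := by
          have : 0 ≤ α / n * V := by positivity
          nlinarith
      _ = α / (512 * n) * V := by field_simp
  calc Real.exp (lam * V) * (1 + lam * ∑ i, p i * Δ i +
        lam * (4 * α * (lam * ρ)) * ∑ i, p i * |Δ i|)
      ≤ Real.exp (lam * V) * (1 + lam * (-(α / (512 * n)) * V + 5 * α)) := by
        refine mul_le_mul_of_nonneg_left ?_ (Real.exp_pos _).le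
        have h1 := mul_le_mul_of_nonneg_left hΔmean hlam
        have h2 := mul_le_mul_of_nonneg_left hsecond hlam
        have h3 : α / (256 * n) * V = α / (512 * n) * V + α / (512 * n) * V := by
          field_simp; ring
        have h4 : lam * (α / (256 * n) * V) =
          lam * (α / (512 * n) * V) + lam * (α / (512 * n) * V) := by rw [h3]; ring
        linarith
    _ ≤ Real.exp (lam * V) * Real.exp (lam * (-(α / (512 * n)) * V + 5 * α)) := by
        gcongr
        linarith [Real.add_one_le_exp (lam * (-(α / (512 * n)) * V + 5 * α))]
    _ = _ := by rw [← Real.exp_add]; congr 1; ring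

end TwoSided


/-! ### The quantiles -/

/-- The range of parameters: there are `k` quantiles, and `g = (log n) ^ (1 / k)` is large. -/
structure Regime (n k : ℕ) (g : ℝ) : Prop where
  one_le : 1 ≤ k
  large : 10000 ≤ g
  exp_pow : Real.exp (g ^ k) = n

theorem regime_of_lt_kappa {n d : ℕ} (hd : 2 ≤ d) (h : (d : ℝ) < kappa * Real.log (Real.log n)) :
    Regime n (d - 1) ((Real.log n) ^ (1 / ((d : ℝ) - 1))) := by
  have hd' : (2 : ℝ) ≤ d := by exact_mod_cast hd
  have hl4 : 0 < Real.log (10 ^ 4) := Real.log_pos (by norm_num)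
  have hll : (d : ℝ) * Real.log (10 ^ 4) < Real.log (Real.log n) := by
    unfold kappa at h
    rwa [one_div, inv_mul_eq_div, lt_div_iff₀ hl4] at h
  have hL0 : 0 ≤ Real.log n := Real.log_natCast_nonneg n
  have hllpos : 0 < Real.log (Real.log n) := lt_trans (by positivity) hll
  have hL1 : 1 < Real.log n := (Real.log_pos_iff hL0).1 hllpos
  have hn : 0 < n := by
    rcases Nat.eq_zero_or_pos n with rfl | hn
    · norm_num at hL1
    · exact hn
  have hk : ((d - 1 : ℕ) : ℝ) = (d : ℝ) - 1 := by push_cast [Nat.cast_sub (by omega : 1 ≤ d)]; ring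
  have hk0 : (0 : ℝ) < (d : ℝ) - 1 := by linarith
  refine ⟨by omega, ?_, ?_⟩
  · have hg : 0 < (Real.log n) ^ (1 / ((d : ℝ) - 1)) := Real.rpow_pos_of_pos (by linarith) _
    rw [show (10000 : ℝ) = 10 ^ 4 by norm_num, ← Real.log_le_log_iff (by norm_num) hg,
      Real.log_rpow (by linarith), one_div, inv_mul_eq_div, le_div_iff₀ hk0]
    nlinarith
  · rw [← Real.rpow_natCast, ← Real.rpow_mul hL0, hk, one_div_mul_cancel hk0.ne', Real.rpow_one,
      Real.exp_log (by positivity)]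

namespace Regime

variable {n k : ℕ} {g : ℝ}

theorem one_le_g (H : Regime n k g) : 1 ≤ g := by linarith [H.large]

theorem le_pow_of_one_le (H : Regime n k g) {j : ℕ} (hj : 1 ≤ j) : g ≤ g ^ j :=
  le_self_pow₀ H.one_le_g (by omega)

theorem large_pow (H : Regime n k g) {j : ℕ} (hj : 1 ≤ j) : 10000 ≤ g ^ j :=
  H.large.trans (H.le_pow_of_one_le hj)

theorem pow_le (H : Regime n k g) {j : ℕ} (hj : j ≤ k) : g ^ j ≤ g ^ k :=
  pow_le_pow_right₀ H.one_le_g hj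

theorem log_eq (H : Regime n k g) : Real.log n = g ^ k := by rw [← H.exp_pow, Real.log_exp]

theorem n_pos (H : Regime n k g) : 0 < n := by
  have : (0 : ℝ) < n := by rw [← H.exp_pow]; exact Real.exp_pos _
  exact_mod_cast this

theorem large_n (H : Regime n k g) : (10 : ℝ) ^ 11 ≤ n := by
  have h := H.large_pow H.one_le
  have h1 := Real.quadratic_le_exp_of_nonneg (x := g ^ k / 3) (by linarith)
  have h2 : Real.exp (g ^ k / 3) ^ 3 = n := by
    rw [← Real.exp_nat_mul, ← H.exp_pow]; congr 1; push_cast; ring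
  have h3 : (10 : ℝ) ^ 4 ≤ Real.exp (g ^ k / 3) := by nlinarith
  rw [← h2]
  calc (10 : ℝ) ^ 11 ≤ (10 ^ 4) ^ 3 := by norm_num
    _ ≤ _ := by gcongr

theorem rawQuantile_succ (H : Regime n k g) {j : ℕ} (hj : 1 ≤ j) :
    rawQuantile n (k + 1) (j + 1) = Real.exp (-(Real.log 2 / 2) * g ^ j) := by
  have hg : 0 ≤ g := by linarith [H.large]
  have hk : (k : ℝ) ≠ 0 := by have := H.one_le; positivity
  unfold rawQuantile
  rw [if_neg (by omega), H.log_eq, Real.rpow_def_of_pos (by norm_num), ← Real.rpow_natCast g k,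
    ← Real.rpow_mul hg,
    show (k : ℝ) * ((((j + 1 : ℕ) : ℝ) - 1) / (((k + 1 : ℕ) : ℝ) - 1)) = j by
      push_cast; rw [add_sub_cancel_right, add_sub_cancel_right]; field_simp, Real.rpow_natCast]
  congr 1; ring

theorem rawQuantile_one (n k : ℕ) : rawQuantile n (k + 1) 1 = 1 / 2 := by simp [rawQuantile]

theorem rawQuantile_le (H : Regime n k g) {j : ℕ} (hj : 1 ≤ j) :
    rawQuantile n (k + 1) (j + 1) ≤ Real.exp (-(0.34 * g ^ j)) := by
  rw [H.rawQuantile_succ hj]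
  have := H.large_pow hj
  refine Real.exp_le_exp.2 ?_
  nlinarith [Real.log_two_gt_d9]

theorem le_rawQuantile (H : Regime n k g) {j : ℕ} (hj : 1 ≤ j) :
    Real.exp (-(0.35 * g ^ j)) ≤ rawQuantile n (k + 1) (j + 1) := by
  rw [H.rawQuantile_succ hj]
  have := H.large_pow hj
  refine Real.exp_le_exp.2 ?_
  nlinarith [Real.log_two_lt_d9]

theorem rawQuantile_pos (H : Regime n k g) {l : ℕ} (hl : 1 ≤ l) :
    0 < rawQuantile n (k + 1) l := by
  obtain ⟨j, rfl⟩ : ∃ j, l = j + 1 := ⟨l - 1, by omega⟩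
  rcases Nat.eq_zero_or_pos j with rfl | hj
  · rw [rawQuantile_one]; norm_num
  · rw [H.rawQuantile_succ hj]; exact Real.exp_pos _

theorem exp_neg_large_le {x : ℝ} (hx : 900 ≤ x) : Real.exp (-x) ≤ 1 / 900 := by
  rw [Real.exp_neg, one_div]
  exact inv_anti₀ (by norm_num) (by linarith [Real.add_one_le_exp x])

theorem rawQuantile_succ_small (H : Regime n k g) {j : ℕ} (hj : 1 ≤ j) :
    rawQuantile n (k + 1) (j + 1) ≤ 1 / 900 :=
  (H.rawQuantile_le hj).trans (exp_neg_large_le (by linarith [H.large_pow hj]))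

theorem rawQuantile_anti (H : Regime n k g) {l l' : ℕ} (hl : 1 ≤ l) (hll : l ≤ l') :
    rawQuantile n (k + 1) l' ≤ rawQuantile n (k + 1) l := by
  obtain ⟨j, rfl⟩ : ∃ j, l = j + 1 := ⟨l - 1, by omega⟩
  obtain ⟨j', rfl⟩ : ∃ j, l' = j + 1 := ⟨l' - 1, by omega⟩
  rcases Nat.eq_zero_or_pos j with rfl | hj
  · rcases Nat.eq_zero_or_pos j' with rfl | hj'
    · exact le_rfl
    · rw [rawQuantile_one]
      linarith [H.rawQuantile_succ_small hj']
  · rw [H.rawQuantile_succ hj, H.rawQuantile_succ (by omega : 1 ≤ j')]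
    have h1 : g ^ j ≤ g ^ j' := pow_le_pow_right₀ H.one_le_g (by omega)
    have h2 : 0 < Real.log 2 := Real.log_pos (by norm_num)
    refine Real.exp_le_exp.2 ?_
    nlinarith

theorem rawQuantile_le_half (H : Regime n k g) {l : ℕ} (hl : 1 ≤ l) :
    rawQuantile n (k + 1) l ≤ 1 / 2 := by
  rw [← rawQuantile_one n k]
  exact H.rawQuantile_anti le_rfl hl

theorem mul_thinningQuantile (H : Regime n k g) (l : ℕ) :
    n * thinningQuantile n (k + 1) l = (⌈(n : ℝ) * rawQuantile n (k + 1) l⌉ : ℝ) := by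
  have : (n : ℝ) ≠ 0 := by have := H.n_pos; positivity
  unfold thinningQuantile
  field_simp

theorem rawQuantile_le_thinningQuantile (H : Regime n k g) (l : ℕ) :
    rawQuantile n (k + 1) l ≤ thinningQuantile n (k + 1) l := by
  have hn : (0 : ℝ) < n := by have := H.n_pos; positivity
  refine le_of_mul_le_mul_left ?_ hn
  rw [H.mul_thinningQuantile]
  exact Int.le_ceil _

theorem thinningQuantile_le_add (H : Regime n k g) (l : ℕ) :
    thinningQuantile n (k + 1) l ≤ rawQuantile n (k + 1) l + 1 / n := by
  have hn : (0 : ℝ) < n := by have := H.n_pos; positivity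
  refine le_of_mul_le_mul_left ?_ hn
  rw [H.mul_thinningQuantile, mul_add, mul_one_div_cancel hn.ne']
  exact (Int.ceil_lt_add_one _).le

theorem one_div_n_le (H : Regime n k g) : 1 / (n : ℝ) ≤ 1 / 1000 :=
  one_div_le_one_div_of_le (by norm_num) (by linarith [H.large_n])

theorem thinningQuantile_nonneg (H : Regime n k g) {l : ℕ} (hl : 1 ≤ l) :
    0 ≤ thinningQuantile n (k + 1) l :=
  (H.rawQuantile_pos hl).le.trans (H.rawQuantile_le_thinningQuantile l)

theorem thinningQuantile_le (H : Regime n k g) {l : ℕ} (hl : 1 ≤ l) :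
    thinningQuantile n (k + 1) l ≤ 51 / 100 := by
  linarith [H.thinningQuantile_le_add l, H.one_div_n_le, H.rawQuantile_le_half hl]

theorem thinningQuantile_small (H : Regime n k g) {l : ℕ} (hl : 2 ≤ l) :
    thinningQuantile n (k + 1) l ≤ 1 / 4 := by
  obtain ⟨j, rfl⟩ : ∃ j, l = j + 1 := ⟨l - 1, by omega⟩
  linarith [H.thinningQuantile_le_add (j + 1), H.one_div_n_le,
    H.rawQuantile_succ_small (by omega : 1 ≤ j)]

theorem thinningQuantile_anti (H : Regime n k g) {l l' : ℕ} (hl : 1 ≤ l) (hll : l ≤ l') :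
    n * thinningQuantile n (k + 1) l' ≤ n * thinningQuantile n (k + 1) l := by
  rw [H.mul_thinningQuantile, H.mul_thinningQuantile]
  exact_mod_cast Int.ceil_le_ceil
    (mul_le_mul_of_nonneg_left (H.rawQuantile_anti hl hll) (by positivity))

/-- Rounding to a multiple of `1 / n` at most doubles the quantiles in use. -/
theorem thinningQuantile_succ_le (H : Regime n k g) {j : ℕ} (hj : 1 ≤ j) (hjk : j < k) :
    thinningQuantile n (k + 1) (j + 1) ≤ 2 * Real.exp (-(0.34 * g ^ j)) := by
  have h1 : 1 / (n : ℝ) ≤ Real.exp (-(0.34 * g ^ j)) := by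
    rw [one_div, ← H.exp_pow, ← Real.exp_neg]
    refine Real.exp_le_exp.2 ?_
    nlinarith [H.pow_le hjk.le, H.large_pow hj]
  linarith [H.thinningQuantile_le_add (j + 1), H.rawQuantile_le hj]

theorem card_quantileReject (H : Regime n k g) (rk : ℕ → (Fin n → ℕ) → Equiv.Perm (Fin n)) (t : ℕ)
    (v : Fin n → ℕ) {l : ℕ} (hl : 1 ≤ l)
    [DecidablePred fun b => quantileReject (thinningQuantile n (k + 1)) rk t v l b] :
    ((Finset.univ.filter fun b =>
      quantileReject (thinningQuantile n (k + 1)) rk t v l b).card : ℝ) =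
      n * thinningQuantile n (k + 1) l := by
  have hn : (1 : ℝ) ≤ n := by exact_mod_cast H.n_pos
  have hc0 : 0 ≤ ⌈(n : ℝ) * rawQuantile n (k + 1) l⌉ :=
    Int.ceil_nonneg (mul_nonneg (by positivity) (H.rawQuantile_pos hl).le)
  obtain ⟨c, hc⟩ := Int.eq_ofNat_of_zero_le hc0
  have hcr : (n : ℝ) * thinningQuantile n (k + 1) l = c := by
    rw [H.mul_thinningQuantile, hc]; simp
  have hcn : c ≤ n := by
    have : (c : ℝ) ≤ n := by
      rw [← hcr]
      nlinarith [H.thinningQuantile_le hl]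
    exact_mod_cast this
  rw [hcr]
  have h1 : (Finset.univ.filter fun b =>
      quantileReject (thinningQuantile n (k + 1)) rk t v l b).card =
      (Finset.univ.filter fun i : Fin n => (i : ℕ) < c).card := by
    refine Finset.card_equiv (rk t v) fun b => ?_
    simp only [Finset.mem_filter, Finset.mem_univ, true_and, quantileReject, hcr]
    rw [Nat.cast_le]
    exact Nat.succ_le_iff
  rw [h1, Fin.card_filter_val_lt, min_eq_right hcn]

/-! ### The transition probabilities of the thinning process -/

/-- The sum of the probabilities of reaching the samples after the `a`-th one is dominated by a
geometric series. -/
theorem sum_prod_quantile_le (H : Regime n k g) {a : ℕ} (ha : 1 ≤ a) (hak : a ≤ k) :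
    ∑ j ∈ Finset.Icc (a + 1) (k + 1), ∏ l ∈ Finset.Ico 1 j, thinningQuantile n (k + 1) l ≤
      4 / 3 * ∏ l ∈ Finset.Ico 1 (a + 1), thinningQuantile n (k + 1) l := by
  set D := fun j => ∏ l ∈ Finset.Ico 1 j, thinningQuantile n (k + 1) l with hD
  have hD0 : ∀ j, 0 ≤ D j := fun j => Finset.prod_nonneg fun l hl =>
    H.thinningQuantile_nonneg (Finset.mem_Ico.1 hl).1
  have hrec : ∀ j, a + 1 ≤ j → D (j + 1) ≤ 1 / 4 * D j := by
    intro j hj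
    simp only [hD]
    rw [Finset.prod_Ico_succ_top (by omega), mul_comm]
    exact mul_le_mul_of_nonneg_right (H.thinningQuantile_small (by omega)) (hD0 j)
  have key : ∀ m, ∑ j ∈ Finset.Ico (a + 1) (a + 1 + m), D j + 4 / 3 * D (a + 1 + m) ≤
      4 / 3 * D (a + 1) := by
    intro m
    induction m with
    | zero => simp
    | succ m ih =>
      rw [← add_assoc, Finset.sum_Ico_succ_top (by omega)]
      have := hrec (a + 1 + m) (by omega)
      linarith
  have h := key (k + 1 - a)
  rw [show a + 1 + (k + 1 - a) = k + 1 + 1 by omega] at h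
  have h2 : Finset.Icc (a + 1) (k + 1) = Finset.Ico (a + 1) (k + 1 + 1) := by
    ext; simp only [Finset.mem_Icc, Finset.mem_Ico]; omega
  rw [h2]
  linarith [hD0 (k + 1 + 1)]

section Kernel

variable {Ω : Type*} [MeasurableSpace Ω] {P : Measure Ω} [IsProbabilityMeasure P]
  {B : ℕ → ℕ → Ω → Fin n} {rk : ℕ → (Fin n → ℕ) → Equiv.Perm (Fin n)}

open Classical in
/-- The `j`-th sample is reached with the product of the previous quantiles as its probability, and
then it hits a given bin with probability `1 / n`. -/
theorem mul_recipientProb (H : Regime n k g) (hB : ∀ t j, Measurable (B t j))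
    (hunif : ∀ t j b, P.real {ω | B t j ω = b} = 1 / (n : ℝ))
    (hind : iIndepFun (fun p : ℕ × ℕ => B p.1 p.2) P) (t : ℕ) (v : Fin n → ℕ) (i : Fin n) :
    n * recipientProb P (k + 1) (quantileReject (thinningQuantile n (k + 1)) rk) B t v i =
      ∑ j ∈ (Finset.Icc 1 (k + 1)).filter (fun j => j < k + 1 →
          ¬ quantileReject (thinningQuantile n (k + 1)) rk t v j i),
        ∏ l ∈ Finset.Ico 1 j, thinningQuantile n (k + 1) l := by
  have hn : (n : ℝ) ≠ 0 := by have := H.n_pos; positivity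
  rw [recipientProb_eq (by omega) hB hunif hind t v (thinningQuantile n (k + 1))
    (fun l hl _ => H.card_quantileReject rk t v hl), ← mul_assoc, mul_one_div_cancel hn, one_mul]

theorem quantileReject_anti (H : Regime n k g) {t : ℕ} {v : Fin n → ℕ} {l l' : ℕ} {i : Fin n}
    (hl : 1 ≤ l) (hll : l ≤ l')
    (h : quantileReject (thinningQuantile n (k + 1)) rk t v l' i) :
    quantileReject (thinningQuantile n (k + 1)) rk t v l i :=
  le_trans h (H.thinningQuantile_anti hl hll)

theorem prod_quantile_nonneg (H : Regime n k g) (j : ℕ) :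
    0 ≤ ∏ l ∈ Finset.Ico 1 j, thinningQuantile n (k + 1) l :=
  Finset.prod_nonneg fun _ hl => H.thinningQuantile_nonneg (Finset.mem_Ico.1 hl).1

/-- A bin that is rejected by the `a`-th decision can only be reached by the later samples. -/
theorem recipientProb_le_of_reject (H : Regime n k g) (hB : ∀ t j, Measurable (B t j))
    (hunif : ∀ t j b, P.real {ω | B t j ω = b} = 1 / (n : ℝ))
    (hind : iIndepFun (fun p : ℕ × ℕ => B p.1 p.2) P) {t : ℕ} {v : Fin n → ℕ} {i : Fin n} {a : ℕ}
    (ha : 1 ≤ a) (hak : a ≤ k)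
    (h : quantileReject (thinningQuantile n (k + 1)) rk t v a i) :
    n * recipientProb P (k + 1) (quantileReject (thinningQuantile n (k + 1)) rk) B t v i ≤
      4 / 3 * thinningQuantile n (k + 1) a := by
  classical
  rw [H.mul_recipientProb hB hunif hind]
  calc ∑ j ∈ (Finset.Icc 1 (k + 1)).filter (fun j => j < k + 1 →
          ¬ quantileReject (thinningQuantile n (k + 1)) rk t v j i),
        ∏ l ∈ Finset.Ico 1 j, thinningQuantile n (k + 1) l
      ≤ ∑ j ∈ Finset.Icc (a + 1) (k + 1), ∏ l ∈ Finset.Ico 1 j, thinningQuantile n (k + 1) l := by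
        refine Finset.sum_le_sum_of_subset_of_nonneg ?_ fun j _ _ => H.prod_quantile_nonneg j
        intro j hj
        rw [Finset.mem_filter, Finset.mem_Icc] at hj
        rw [Finset.mem_Icc]
        refine ⟨?_, hj.1.2⟩
        by_contra hja
        exact hj.2 (by omega) (H.quantileReject_anti hj.1.1 (by omega) h)
    _ ≤ 4 / 3 * ∏ l ∈ Finset.Ico 1 (a + 1), thinningQuantile n (k + 1) l :=
        H.sum_prod_quantile_le ha hak
    _ ≤ 4 / 3 * (1 * thinningQuantile n (k + 1) a) := by
        rw [Finset.prod_Ico_succ_top ha]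
        have h0 := H.thinningQuantile_nonneg ha
        gcongr
        exact Finset.prod_le_one (fun l hl => H.thinningQuantile_nonneg (Finset.mem_Ico.1 hl).1)
          fun l hl => (H.thinningQuantile_le (Finset.mem_Ico.1 hl).1).trans (by norm_num)
    _ = _ := by ring

theorem recipientProb_le_two_div (H : Regime n k g) (hB : ∀ t j, Measurable (B t j))
    (hunif : ∀ t j b, P.real {ω | B t j ω = b} = 1 / (n : ℝ))
    (hind : iIndepFun (fun p : ℕ × ℕ => B p.1 p.2) P) (t : ℕ) (v : Fin n → ℕ) (i : Fin n) :
    recipientProb P (k + 1) (quantileReject (thinningQuantile n (k + 1)) rk) B t v i ≤ 2 / n := by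
  classical
  have hn : (0 : ℝ) < n := by have := H.n_pos; positivity
  rw [le_div_iff₀ hn, mul_comm, H.mul_recipientProb hB hunif hind]
  have h1 := H.sum_prod_quantile_le le_rfl H.one_le
  rw [Finset.prod_Ico_succ_top le_rfl, Finset.Ico_self, Finset.prod_empty, one_mul] at h1
  have h2 := H.thinningQuantile_le le_rfl
  have hsplit : Finset.Icc 1 (k + 1) = insert 1 (Finset.Icc (1 + 1) (k + 1)) := by
    ext; simp only [Finset.mem_Icc, Finset.mem_insert]; omega
  calc ∑ j ∈ (Finset.Icc 1 (k + 1)).filter (fun j => j < k + 1 →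
          ¬ quantileReject (thinningQuantile n (k + 1)) rk t v j i),
        ∏ l ∈ Finset.Ico 1 j, thinningQuantile n (k + 1) l
      ≤ ∑ j ∈ Finset.Icc 1 (k + 1), ∏ l ∈ Finset.Ico 1 j, thinningQuantile n (k + 1) l :=
        Finset.sum_le_sum_of_subset_of_nonneg (Finset.filter_subset _ _)
          fun j _ _ => H.prod_quantile_nonneg j
    _ = 1 + ∑ j ∈ Finset.Icc (1 + 1) (k + 1),
          ∏ l ∈ Finset.Ico 1 j, thinningQuantile n (k + 1) l := by
        rw [hsplit, Finset.sum_insert (by simp)]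
        simp
    _ ≤ 2 := by linarith

theorem le_recipientProb_of_not_reject (H : Regime n k g) (hB : ∀ t j, Measurable (B t j))
    (hunif : ∀ t j b, P.real {ω | B t j ω = b} = 1 / (n : ℝ))
    (hind : iIndepFun (fun p : ℕ × ℕ => B p.1 p.2) P) {t : ℕ} {v : Fin n → ℕ} {i : Fin n}
    (h : ¬ quantileReject (thinningQuantile n (k + 1)) rk t v 1 i) :
    5 / 4 / n ≤
      recipientProb P (k + 1) (quantileReject (thinningQuantile n (k + 1)) rk) B t v i := by
  classical
  have hn : (0 : ℝ) < n := by have := H.n_pos; positivity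
  have hk := H.one_le
  rw [div_le_iff₀ hn, mul_comm, H.mul_recipientProb hB hunif hind]
  have h1 : (1 : ℝ) / 2 ≤ thinningQuantile n (k + 1) 1 := by
    rw [← rawQuantile_one n k]
    exact H.rawQuantile_le_thinningQuantile 1
  calc (5 : ℝ) / 4
      ≤ ∑ j ∈ ({1, 2} : Finset ℕ), ∏ l ∈ Finset.Ico 1 j, thinningQuantile n (k + 1) l := by
        rw [Finset.sum_pair (by norm_num)]
        simp
        linarith
    _ ≤ _ := by
        refine Finset.sum_le_sum_of_subset_of_nonneg ?_ fun j _ _ => H.prod_quantile_nonneg j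
        intro j hj
        rw [Finset.mem_filter, Finset.mem_Icc]
        have hj' : j = 1 ∨ j = 2 := by simpa using hj
        exact ⟨by omega, fun _ hr => h (H.quantileReject_anti le_rfl (by omega) hr)⟩

end Kernel

end Regime

/-- If at most `N` bins have excess at least `z`, then these bins have rank at most `N`. -/
theorem rank_le_card_of_isRanking {n : ℕ} {v : Fin n → ℕ} {σ : Equiv.Perm (Fin n)}
    (hσ : IsRanking v σ) {z : ℝ} {i : Fin n} (hi : z ≤ excess v i) :
    (σ i : ℕ) + 1 ≤ (Finset.univ.filter fun b => z ≤ excess v b).card := by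
  have h1 : (Finset.univ.filter fun b => (σ b : ℕ) < (σ i : ℕ) + 1).card = (σ i : ℕ) + 1 := by
    have : (Finset.univ.filter fun b => (σ b : ℕ) < (σ i : ℕ) + 1).card =
        (Finset.univ.filter fun b : Fin n => (b : ℕ) < (σ i : ℕ) + 1).card :=
      Finset.card_equiv σ fun b => by simp
    rw [this, Fin.card_filter_val_lt, min_eq_right (σ i).isLt]
  rw [← h1]
  refine Finset.card_le_card fun b hb => ?_
  rw [Finset.mem_filter] at hb ⊢
  refine ⟨Finset.mem_univ b, hi.trans ?_⟩
  have : v i ≤ v b := by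
    by_contra hlt
    have h2 : (σ i : ℕ) < σ b := hσ b i (not_le.1 hlt)
    omega
  unfold excess
  have : (v i : ℝ) ≤ v b := by exact_mod_cast this
  linarith


/-! ### The stages of the layered induction -/

/-- A bound on the potential limits the number of bins above a level. -/
theorem card_mul_exp_le_expPotential {n : ℕ} {β z z' : ℝ} (hβ : 0 ≤ β) (v : Fin n → ℕ) :
    ((Finset.univ.filter fun i => z' ≤ excess v i).card : ℝ) * Real.exp (β * (z' - z)) ≤
      expPotential β z v := by
  calc ((Finset.univ.filter fun i => z' ≤ excess v i).card : ℝ) * Real.exp (β * (z' - z))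
      = ∑ i ∈ Finset.univ.filter fun i => z' ≤ excess v i, Real.exp (β * (z' - z)) := by simp
    _ ≤ ∑ i ∈ Finset.univ.filter fun i => z' ≤ excess v i, Real.exp (β * (excess v i - z)) := by
        refine Finset.sum_le_sum fun i hi => Real.exp_le_exp.2 ?_
        have := (Finset.mem_filter.1 hi).2
        gcongr
    _ ≤ expPotential β z v :=
        Finset.sum_le_sum_of_subset_of_nonneg (Finset.subset_univ _)
          fun _ _ _ => (Real.exp_pos _).le

namespace Regime

variable {n k : ℕ} {g : ℝ}

theorem pow_le_n (H : Regime n k g) : g ^ k ≤ n := by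
  rw [← H.exp_pow]
  linarith [Real.add_one_le_exp (g ^ k)]

theorem two_mul_k_le (H : Regime n k g) : 2 * k ≤ n := by
  have hg := H.large
  have h1 : (k : ℝ) ≤ g ^ k := by
    have h : ((k : ℕ) : ℝ) ≤ (2 : ℝ) ^ k := by exact_mod_cast Nat.lt_two_pow_self.le
    exact h.trans (pow_le_pow_left₀ (by norm_num) (by linarith) k)
  have h2 : 2 * g ^ k ≤ n := by
    rw [← H.exp_pow]
    have := Real.quadratic_le_exp_of_nonneg (x := g ^ k) (by positivity)
    nlinarith [H.large_pow H.one_le]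
  have h3 : ((2 * k : ℕ) : ℝ) ≤ n := by push_cast; linarith
  exact_mod_cast h3

/-- The time union bound of one stage costs at most `1 / n ^ 4`. -/
theorem window_mul_le (H : Regime n k g) {c m : ℕ} (hc : c < 2 * k) {x : ℝ}
    (hx : x ≤ Real.exp (-(9 * g ^ k))) :
    ((m + 1 - (m - c * n ^ 3) : ℕ) : ℝ) * x ≤ 1 / (n : ℝ) ^ 4 := by
  have hn := H.n_pos
  have hn' : (1 : ℝ) ≤ n := by exact_mod_cast hn
  have h1 : m + 1 - (m - c * n ^ 3) ≤ n ^ 4 := by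
    have h2 : 1 ≤ n ^ 3 := Nat.one_le_pow _ _ hn
    have h3 : (c + 1) * n ^ 3 ≤ n * n ^ 3 :=
      Nat.mul_le_mul_right _ (by have := H.two_mul_k_le; omega)
    calc m + 1 - (m - c * n ^ 3) ≤ c * n ^ 3 + 1 := by omega
      _ ≤ (c + 1) * n ^ 3 := by rw [Nat.succ_mul]; omega
      _ ≤ n ^ 4 := by rw [pow_succ' n 3]; exact h3
  have h2 : ((m + 1 - (m - c * n ^ 3) : ℕ) : ℝ) ≤ (n : ℝ) ^ 4 := by exact_mod_cast h1
  have h3 : Real.exp (-(9 * g ^ k)) = 1 / (n : ℝ) ^ 9 := by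
    rw [Real.exp_neg, ← H.exp_pow, ← Real.exp_nat_mul, one_div]
    norm_num
  calc ((m + 1 - (m - c * n ^ 3) : ℕ) : ℝ) * x
      ≤ ((m + 1 - (m - c * n ^ 3) : ℕ) : ℝ) * Real.exp (-(9 * g ^ k)) := by gcongr
    _ ≤ (n : ℝ) ^ 4 * Real.exp (-(9 * g ^ k)) := by gcongr
    _ = 1 / (n : ℝ) ^ 5 := by rw [h3]; field_simp
    _ ≤ 1 / (n : ℝ) ^ 4 := by
        apply one_div_le_one_div_of_le (by positivity)
        exact pow_le_pow_right₀ hn' (by norm_num)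

/-- The factor `lam = n ^ (-1 / 4)` still leaves `lam * n` far above `log n`. This is the tail bound
for the exponentials of potentials of order `n`. -/
theorem two_mul_exp_div_le (H : Regime n k g) {a b : ℝ}
    (hab : a + 1 ≤ b) :
    2 * Real.exp (Real.exp (-(g ^ k / 4)) * (a * n)) /
        Real.exp (Real.exp (-(g ^ k / 4)) * (b * n)) ≤ Real.exp (-(9 * g ^ k)) := by
  have hX := H.large_pow H.one_le
  have h2 : (2 : ℝ) ≤ Real.exp 1 := by linarith [Real.exp_one_gt_d9]
  have h3 : Real.exp (-(g ^ k / 4)) * n = Real.exp (3 / 4 * g ^ k) := by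
    rw [← H.exp_pow, ← Real.exp_add]; congr 1; ring
  have h4 := Real.quadratic_le_exp_of_nonneg (x := 3 / 4 * g ^ k) (by positivity)
  have h5 : 1 + 9 * g ^ k ≤ Real.exp (3 / 4 * g ^ k) := by nlinarith
  calc 2 * Real.exp (Real.exp (-(g ^ k / 4)) * (a * n)) /
        Real.exp (Real.exp (-(g ^ k / 4)) * (b * n))
      ≤ Real.exp 1 * Real.exp (Real.exp (-(g ^ k / 4)) * (a * n)) /
        Real.exp (Real.exp (-(g ^ k / 4)) * (b * n)) := by gcongr
    _ = Real.exp (1 - (b - a) * Real.exp (3 / 4 * g ^ k)) := by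
        rw [← Real.exp_add, ← Real.exp_sub, ← h3]; congr 1; ring
    _ ≤ Real.exp (-(9 * g ^ k)) := by
        refine Real.exp_le_exp.2 ?_
        have : 1 * Real.exp (3 / 4 * g ^ k) ≤ (b - a) * Real.exp (3 / 4 * g ^ k) := by
          gcongr; linarith
        linarith

/-- The contribution of a single bin to a potential is at most `n ^ 0.1125`, up to a constant, which
`lam = n ^ (-1 / 4)` makes small. -/
theorem lam_mul_exp_le (H : Regime n k g) :
    Real.exp (-(g ^ k / 4)) * (2 * Real.exp (0.1125 * g ^ k)) ≤ 1 / 100 := by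
  have hX := H.large_pow H.one_le
  have h := exp_neg_large_le (x := 0.1375 * g ^ k) (by linarith)
  have h2 : Real.exp (-(g ^ k / 4)) * Real.exp (0.1125 * g ^ k) = Real.exp (-(0.1375 * g ^ k)) := by
    rw [← Real.exp_add]; congr 1; ring
  calc Real.exp (-(g ^ k / 4)) * (2 * Real.exp (0.1125 * g ^ k))
      = 2 * (Real.exp (-(g ^ k / 4)) * Real.exp (0.1125 * g ^ k)) := by ring
    _ ≤ 2 * (1 / 900) := by rw [h2]; gcongr
    _ ≤ 1 / 100 := by norm_num

theorem three_mul_exp_le (H : Regime n k g) {j : ℕ} (hj : 1 ≤ j) {β : ℝ}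
    (hβ : 25 ≤ β) (hβg : β ≤ g ^ j / 4) :
    2 * (3 * Real.exp (-(0.34 * g ^ j)) * Real.exp β) ≤ β / 4 := by
  have hX := H.large_pow hj
  have h := exp_neg_large_le (x := 0.09 * g ^ j) (by linarith)
  have h2 : Real.exp (-(0.34 * g ^ j)) * Real.exp β ≤ Real.exp (-(0.09 * g ^ j)) := by
    rw [← Real.exp_add]; exact Real.exp_le_exp.2 (by linarith)
  linarith

end Regime

/-- The data of a thinning process with `k` quantiles. -/
structure ThinningSetup {Ω : Type*} [MeasurableSpace Ω] (n k : ℕ) (g : ℝ) (P : Measure Ω)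
    (B : ℕ → ℕ → Ω → Fin n) (rk : ℕ → (Fin n → ℕ) → Equiv.Perm (Fin n)) : Prop where
  regime : Regime n k g
  ranking : ∀ t x, IsRanking x (rk t x)
  measurable : ∀ t j, Measurable (B t j)
  uniform : ∀ t j b, P.real {ω | B t j ω = b} = 1 / (n : ℝ)
  indep : iIndepFun (fun p : ℕ × ℕ => B p.1 p.2) P

/-- The rejection rule of the thinning process with the quantiles `thinningQuantile n (k + 1)`. -/
abbrev thinningReject {n : ℕ} (k : ℕ) (rk : ℕ → (Fin n → ℕ) → Equiv.Perm (Fin n)) :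
    ℕ → (Fin n → ℕ) → ℕ → Fin n → Prop :=
  quantileReject (thinningQuantile n (k + 1)) rk

/-- The excess load at which the `j`-th layer starts. The distance `100000 * g` between consecutive
levels, times the exponent `g ^ j / 400` of the potential of the `j`-th layer, exceeds the logarithm
`0.35 * g ^ (j + 1)` of the inverse of the next quantile. -/
def layerLevel (g : ℝ) (j : ℕ) : ℝ := 100000 * j * g

/-- All excess loads have absolute value of order at most `log n = g ^ k`. The bound is `n ^ 11`, so
that a potential with expectation at most of order `n ^ 2` violates it with probability at most `n ^ (-9)`,
which survives a union bound over `n ^ 4` times. -/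
def BaseGood {n : ℕ} (k : ℕ) (g : ℝ) (v : Fin n → ℕ) : Prop :=
  coshPotential (1 / 1000) v ≤ Real.exp (11 * g ^ k)

/-- The bins of the `j`-th layer are few enough to be rejected by the first `j + 1` decisions. -/
def FewAbove {n : ℕ} (k : ℕ) (g : ℝ) (j : ℕ) (v : Fin n → ℕ) : Prop :=
  ((Finset.univ.filter fun i => layerLevel g j ≤ excess v i).card : ℝ) ≤
    n * rawQuantile n (k + 1) (j + 1)

theorem layerLevel_nonneg {g : ℝ} (hg : 0 ≤ g) (j : ℕ) : 0 ≤ layerLevel g j := by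
  unfold layerLevel; positivity

theorem BaseGood.abs_excess_le {n k : ℕ} {g : ℝ} {v : Fin n → ℕ} (h : BaseGood k g v) (i : Fin n) :
    |excess v i| ≤ 11000 * g ^ k := by
  have h1 := exp_le_expPotential (1 / 1000) 0 v i
  have h2 := exp_le_expPotential (-(1 / 1000)) 0 v i
  have h3 := expPotential_nonneg (1 / 1000) 0 v
  have h4 := expPotential_nonneg (-(1 / 1000)) 0 v
  unfold BaseGood coshPotential at h
  have h5 := Real.exp_le_exp.1 (h1.trans (by linarith : _ ≤ Real.exp (11 * g ^ k)))
  have h6 := Real.exp_le_exp.1 (h2.trans (by linarith : _ ≤ Real.exp (11 * g ^ k)))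
  rw [abs_le]
  constructor <;> linarith

namespace ThinningSetup

variable {Ω : Type*} [MeasurableSpace Ω] {n k : ℕ} {g : ℝ} {P : Measure Ω} [IsProbabilityMeasure P]
    {B : ℕ → ℕ → Ω → Fin n} {rk : ℕ → (Fin n → ℕ) → Equiv.Perm (Fin n)}

/-- One stage of the layered induction, with recovery time `n ^ 3`. -/
theorem stage (S : ThinningSetup n k g P B rk) {Good : (Fin n → ℕ) → Prop}
    {f : (Fin n → ℕ) → ℝ} (hf : ∀ v, 0 ≤ f v) {r b K : ℝ} (hr : 0 ≤ r) (hr1 : r ≤ 1)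
    (hK : 0 < K)
    (hdrift : ∀ t v, Good v →
      ∑ i, recipientProb P (k + 1) (thinningReject k rk) B t v i * f (v + Pi.single i 1) ≤
        (1 - r) * f v + r * b)
    (hzero : f 0 ≤ b) (hb : 1 ≤ b) (hstart : ∀ v, Good v → f v ≤ Real.exp (r * n ^ 3))
    (hbK : 2 * b / K ≤ Real.exp (-(9 * g ^ k))) {c m : ℕ} (hc : c < 2 * k) :
    P.real (goodOn (k + 1) (thinningReject k rk) B (fun v => Good v ∧ f v ≤ K)
        (m - c * n ^ 3) m)ᶜ ≤
      P.real (goodOn (k + 1) (thinningReject k rk) B Good (m - (c + 1) * n ^ 3) m)ᶜ +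
        1 / (n : ℝ) ^ 4 := by
  have hdecay : (1 - r) ^ (n ^ 3) * Real.exp (r * n ^ 3) ≤ b := by
    refine le_trans ?_ hb
    calc (1 - r) ^ (n ^ 3) * Real.exp (r * n ^ 3)
        ≤ Real.exp (-r) ^ (n ^ 3) * Real.exp (r * n ^ 3) := by
          gcongr
          linarith [Real.add_one_le_exp (-r)]
      _ = 1 := by
          rw [← Real.exp_nat_mul, ← Real.exp_add]
          push_cast
          rw [show (n : ℝ) ^ 3 * -r + r * n ^ 3 = 0 by ring, Real.exp_zero]
  have h := measureReal_stage_le (d := k + 1) (rej := thinningReject k rk) (by omega) S.measurable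
    S.indep Good f hf hr hr1 (M := Real.exp (r * n ^ 3)) (Real.exp_pos _).le hK
    (a := m - (c + 1) * n ^ 3) (a' := m - c * n ^ 3) (m := m) (τ := n ^ 3) hdrift hzero
    (by
      rw [Nat.succ_mul]
      rcases Nat.eq_zero_or_pos (m - (c * n ^ 3 + n ^ 3)) with h0 | h0
      · exact Or.inl h0
      · exact Or.inr ⟨hstart, hdecay, by omega⟩)
    (by rw [Nat.succ_mul]; omega)
  exact h.trans (by linarith [S.regime.window_mul_le (m := m) hc hbK])

theorem sum_prob (S : ThinningSetup n k g P B rk) (t : ℕ) (v : Fin n → ℕ) :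
    ∑ i, recipientProb P (k + 1) (thinningReject k rk) B t v i = 1 :=
  sum_recipientProb (by omega) S.measurable t v

theorem prob_le (S : ThinningSetup n k g P B rk) (t : ℕ) (v : Fin n → ℕ) (i : Fin n) :
    recipientProb P (k + 1) (thinningReject k rk) B t v i ≤ 2 / n :=
  S.regime.recipientProb_le_two_div S.measurable S.uniform S.indep t v i

/-- The bins rejected by the first decision are the most loaded ones. They are chosen with
probability at most `3 / (4 n)`, the other bins with probability at least `5 / (4 n)`. -/
theorem exists_top (S : ThinningSetup n k g P B rk) (t : ℕ) (v : Fin n → ℕ) :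
    ∃ T : Finset (Fin n), T.Nonempty ∧
      (∀ i ∈ T, recipientProb P (k + 1) (thinningReject k rk) B t v i ≤ 3 / 4 / n) ∧
      (∀ i, i ∉ T → 5 / 4 / n ≤ recipientProb P (k + 1) (thinningReject k rk) B t v i) ∧
      ∀ i ∈ T, ∀ j, j ∉ T → excess v j ≤ excess v i := by
  classical
  have H := S.regime
  have hn : (0 : ℝ) < n := by have := H.n_pos; positivity
  refine ⟨Finset.univ.filter fun b => thinningReject k rk t v 1 b, ?_, ?_, ?_, ?_⟩
  · rw [← Finset.card_pos]
    have h1 := H.card_quantileReject rk t v (l := 1) le_rfl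
    have h2 := H.rawQuantile_le_thinningQuantile 1
    have h3 := H.rawQuantile_pos (l := 1) le_rfl
    have h4 : (0 : ℝ) < n * thinningQuantile n (k + 1) 1 := mul_pos hn (by linarith)
    rw [← h1] at h4
    exact_mod_cast h4
  · intro i hi
    have h1 := H.recipientProb_le_of_reject S.measurable S.uniform S.indep le_rfl H.one_le
      (Finset.mem_filter.1 hi).2
    have h2 := H.thinningQuantile_le (l := 1) le_rfl
    rw [le_div_iff₀ hn, mul_comm]
    linarith
  · intro i hi
    refine H.le_recipientProb_of_not_reject S.measurable S.uniform S.indep fun h => hi ?_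
    exact Finset.mem_filter.2 ⟨Finset.mem_univ _, h⟩
  · intro i hi j hj
    have hi' := (Finset.mem_filter.1 hi).2
    have hj' : ¬ thinningReject k rk t v 1 j := fun h =>
      hj (Finset.mem_filter.2 ⟨Finset.mem_univ _, h⟩)
    have hlt := lt_of_le_of_lt hi' (not_le.1 hj')
    rw [Nat.cast_lt] at hlt
    have hle : v j ≤ v i := by
      by_contra h
      have : (rk t v j : ℕ) < rk t v i := S.ranking t v i j (not_le.1 h)
      omega
    have : (v j : ℝ) ≤ v i := by exact_mod_cast hle
    unfold excess
    linarith

/-- The excess loads are at most of order `log n` in absolute value. -/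
theorem base_stage (S : ThinningSetup n k g P B rk) {c m : ℕ} (hc : c < 2 * k) :
    P.real (goodOn (k + 1) (thinningReject k rk) B (BaseGood k g) (m - c * n ^ 3) m)ᶜ ≤
      1 / (n : ℝ) ^ 4 := by
  have H := S.regime
  have hn : (0 : ℝ) < n := by have := H.n_pos; positivity
  have hn1 := H.large_n
  have hX := H.large_pow H.one_le
  have hr1 : 1 / 1000 / (256 * (n : ℝ)) ≤ 1 := by
    rw [div_le_one (by positivity)]; linarith
  have h := measureReal_stage_le (P := P) (B := B) (d := k + 1) (rej := thinningReject k rk)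
    (by omega) S.measurable
    S.indep (fun _ => True) (coshPotential (1 / 1000)) (fun v => coshPotential_nonneg _ v)
    (r := 1 / 1000 / (256 * (n : ℝ))) (b := 1280 * n) (M := 0) (K := Real.exp (11 * g ^ k))
    (by positivity) hr1 le_rfl (Real.exp_pos _)
    (a := 0) (a' := m - c * n ^ 3) (m := m) (τ := 0)
    (fun t v _ => by
      obtain ⟨T, hT0, hT, hS, hord⟩ := S.exists_top t v
      have := sum_mul_coshPotential_le H.n_pos (S.sum_prob t v) (S.prob_le t v)
        (fun i => recipientProb_nonneg t v i) hT0 hT hS hord (α := 1 / 1000) (by norm_num) le_rfl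
      refine this.trans (le_of_eq ?_)
      congr 1
      field_simp
      norm_num)
    (by
      unfold coshPotential
      rw [expPotential_zero_load, expPotential_zero_load]
      simp
      linarith)
    (Or.inl rfl) (Nat.zero_le _)
  have h0 : (goodOn (k + 1) (thinningReject k rk) B (fun _ => True) 0 m)ᶜ = (∅ : Set Ω) := by
    ext; simp [goodOn]
  rw [h0, measureReal_empty, zero_add] at h
  have hbK : 2 * (1280 * (n : ℝ)) / Real.exp (11 * g ^ k) ≤ Real.exp (-(9 * g ^ k)) := by
    rw [div_le_iff₀ (Real.exp_pos _), ← Real.exp_add,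
      show -(9 * g ^ k) + 11 * g ^ k = g ^ k + g ^ k by ring, Real.exp_add, H.exp_pow]
    nlinarith
  refine le_trans (le_of_eq ?_) (h.trans (S.regime.window_mul_le hc hbK))
  simp only [true_and]
  rfl

/-- With high probability, the two-sided potential with a hundred times smaller exponent is of
order `n`, so that few bins lie in the first layer. -/
theorem few_stage (S : ThinningSetup n k g P B rk) {c m : ℕ} (hc : c < 2 * k) :
    P.real (goodOn (k + 1) (thinningReject k rk) B (fun v => BaseGood k g v ∧ FewAbove k g 1 v)
        (m - c * n ^ 3) m)ᶜ ≤
      P.real (goodOn (k + 1) (thinningReject k rk) B (BaseGood k g) (m - (c + 1) * n ^ 3) m)ᶜ +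
        1 / (n : ℝ) ^ 4 := by
  have H := S.regime
  have hn : (0 : ℝ) < n := by have := H.n_pos; positivity
  have hn1 := H.large_n
  have hX := H.large_pow H.one_le
  set α : ℝ := 1 / 100000 with hα
  set lam := Real.exp (-(g ^ k / 4)) with hlam
  have hlam0 : 0 < lam := Real.exp_pos _
  set r : ℝ := α / (512 * n) with hr
  have hr0 : 0 < r := by positivity
  have hr1 : r ≤ 1 := by
    rw [hr, div_le_one (by positivity), hα]; linarith
  have hbr : 5 * α / r = 2560 * n := by
    rw [hr]; field_simp; norm_num
  have hρ : ∀ v : Fin n → ℕ, BaseGood k g v → ∀ i,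
      Real.exp (α * excess v i) + Real.exp (-α * excess v i) ≤ 2 * Real.exp (0.1125 * g ^ k) := by
    intro v hv i
    have h := abs_le.1 (hv.abs_excess_le i)
    have h1 : Real.exp (α * excess v i) ≤ Real.exp (0.1125 * g ^ k) :=
      Real.exp_le_exp.2 (by rw [hα]; linarith [h.2])
    have h2 : Real.exp (-α * excess v i) ≤ Real.exp (0.1125 * g ^ k) :=
      Real.exp_le_exp.2 (by rw [hα]; linarith [h.1])
    linarith
  have h := S.stage (Good := BaseGood k g) (f := fun v => Real.exp (lam * coshPotential α v))
    (fun v => (Real.exp_pos _).le) (r := r) (b := Real.exp (lam * (2560 * n)))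
    (K := Real.exp (lam * (2561 * n))) hr0.le hr1 (Real.exp_pos _)
    (fun t v hv => by
      obtain ⟨T, hT0, hT, hS, hord⟩ := S.exists_top t v
      have := sum_mul_exp_coshPotential_le H.n_pos (S.sum_prob t v) (S.prob_le t v)
        (fun i => recipientProb_nonneg t v i) hT0 hT hS hord (α := α) (by positivity)
        (by rw [hα]; norm_num) hlam0.le (hρ v hv) S.regime.lam_mul_exp_le
      refine this.trans ((exp_mul_drift_le hr0 hr1).trans (le_of_eq ?_))
      rw [hbr])
    (by
      refine Real.exp_le_exp.2 (mul_le_mul_of_nonneg_left ?_ hlam0.le)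
      unfold coshPotential
      rw [expPotential_zero_load, expPotential_zero_load]
      simp
      linarith)
    (Real.one_le_exp (by positivity))
    (fun v hv => by
      refine Real.exp_le_exp.2 ?_
      have h1 : coshPotential α v ≤ n * (2 * Real.exp (0.1125 * g ^ k)) := by
        unfold coshPotential expPotential
        rw [← Finset.sum_add_distrib]
        simp only [sub_zero]
        calc _ ≤ ∑ _i : Fin n, 2 * Real.exp (0.1125 * g ^ k) :=
              Finset.sum_le_sum fun i _ => hρ v hv i
          _ = _ := by simp
      calc lam * coshPotential α v ≤ lam * (n * (2 * Real.exp (0.1125 * g ^ k))) := by gcongr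
        _ = n * (lam * (2 * Real.exp (0.1125 * g ^ k))) := by ring
        _ ≤ n * (1 / 100) := by gcongr; exact S.regime.lam_mul_exp_le
        _ ≤ n * (α / 512 * n) := by
            gcongr
            rw [hα]; linarith
        _ = r * n ^ 3 := by rw [hr]; field_simp)
    (S.regime.two_mul_exp_div_le (by norm_num)) (m := m) hc
  refine le_trans (measureReal_mono (Set.compl_subset_compl.2 ?_)) h
  intro ω hω s hs1 hs2
  obtain ⟨hv, hV⟩ := hω s hs1 hs2
  refine ⟨hv, ?_⟩
  set v := loadAt (k + 1) (thinningReject k rk) B s ω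
  have hV' : coshPotential α v ≤ 2561 * n :=
    le_of_mul_le_mul_left (Real.exp_le_exp.1 hV) hlam0
  have hcard := card_mul_exp_le_expPotential (β := α) (z := 0) (z' := layerLevel g 1)
    (by positivity) v
  have h1 := expPotential_nonneg (-α) 0 v
  unfold coshPotential at hV'
  have h2 : Real.exp (α * (layerLevel g 1 - 0)) = Real.exp g := by
    congr 1; rw [hα]; unfold layerLevel; push_cast; ring
  rw [h2] at hcard
  have h3 := H.le_rawQuantile (j := 1) le_rfl
  have hg := H.large
  have h4 : 2561 * Real.exp (-g) ≤ rawQuantile n (k + 1) (1 + 1) := by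
    refine le_trans ?_ h3
    have h5 : Real.exp (-(0.35 * g ^ 1)) = Real.exp (0.65 * g) * Real.exp (-g) := by
      rw [← Real.exp_add]; congr 1; ring
    rw [h5]
    gcongr
    linarith [Real.add_one_le_exp (0.65 * g)]
  unfold FewAbove
  calc ((Finset.univ.filter fun i => layerLevel g 1 ≤ excess v i).card : ℝ)
      = ((Finset.univ.filter fun i => layerLevel g 1 ≤ excess v i).card : ℝ) * Real.exp g *
          Real.exp (-g) := by rw [mul_assoc, ← Real.exp_add, add_neg_cancel, Real.exp_zero, mul_one]
    _ ≤ 2561 * n * Real.exp (-g) :=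
        mul_le_mul_of_nonneg_right (by linarith) (Real.exp_pos _).le
    _ = n * (2561 * Real.exp (-g)) := by ring
    _ ≤ _ := by gcongr

/-- The bins of the `j`-th layer are rarely chosen. -/
theorem prob_le_of_fewAbove (S : ThinningSetup n k g P B rk) {j : ℕ} (hj : 1 ≤ j) (hjk : j < k)
    (t : ℕ) {v : Fin n → ℕ} (hv : FewAbove k g j v) {i : Fin n} (hi : layerLevel g j ≤ excess v i) :
    recipientProb P (k + 1) (thinningReject k rk) B t v i ≤ 3 * Real.exp (-(0.34 * g ^ j)) / n := by
  have H := S.regime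
  have hn : (0 : ℝ) < n := by have := H.n_pos; positivity
  have hrej : thinningReject k rk t v (j + 1) i := by
    have h1 := rank_le_card_of_isRanking (S.ranking t v) hi
    have h2 : (((rk t v i : ℕ) + 1 : ℕ) : ℝ) ≤ n * rawQuantile n (k + 1) (j + 1) :=
      le_trans (by exact_mod_cast h1) hv
    exact h2.trans (by gcongr; exact H.rawQuantile_le_thinningQuantile _)
  have h1 := H.recipientProb_le_of_reject S.measurable S.uniform S.indep (by omega) (by omega) hrej
  have h2 := H.thinningQuantile_succ_le hj hjk
  rw [le_div_iff₀ hn, mul_comm]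
  linarith [Real.exp_pos (-(0.34 * g ^ j))]

/-- In the `j`-th layer, excess loads above the level of the layer are at most of order
`log n / g ^ j`. -/
theorem layer_stage (S : ThinningSetup n k g P B rk) {j : ℕ} (hj : 1 ≤ j) (hjk : j < k) {c m : ℕ}
    (hc : c < 2 * k) :
    P.real (goodOn (k + 1) (thinningReject k rk) B (fun v => (BaseGood k g v ∧ FewAbove k g j v) ∧
        expPotential (g ^ j / 4) (layerLevel g j) v ≤ Real.exp (11 * g ^ k)) (m - c * n ^ 3) m)ᶜ ≤
      P.real (goodOn (k + 1) (thinningReject k rk) B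
        (fun v => BaseGood k g v ∧ FewAbove k g j v) (m - (c + 1) * n ^ 3) m)ᶜ +
        1 / (n : ℝ) ^ 4 := by
  have H := S.regime
  have hn : (0 : ℝ) < n := by have := H.n_pos; positivity
  have hn1 := H.large_n
  have hX := H.large_pow H.one_le
  have hx := H.large_pow hj
  have hxX := H.pow_le hjk.le
  have hXn := S.regime.pow_le_n
  have hg := H.large
  -- at this exponent, `exp β` is still absorbed by the `(j + 1)`-th quantile
  set β : ℝ := g ^ j / 4 with hβ
  have hz := layerLevel_nonneg (g := g) (by linarith) j
  set z := layerLevel g j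
  have hβ0 : 0 < β := by linarith
  have hexpβ := Real.add_one_le_exp β
  have hbig : (1 : ℝ) ≤ 16 * Real.exp β / β := by
    rw [le_div_iff₀ hβ0]; linarith
  refine S.stage (f := expPotential β z) (fun v => expPotential_nonneg _ _ v)
    (r := β / (4 * n)) (b := 16 * Real.exp β / β * n) (by positivity) ?_ (Real.exp_pos _)
    ?_ ?_ ?_ ?_ ?_ hc
  · rw [div_le_one (by positivity)]; linarith
  · intro t v hv
    have := sum_mul_expPotential_le H.n_pos (fun i => recipientProb_nonneg t v i) (S.sum_prob t v)
      (S.prob_le t v) hβ0.le (by linarith) (by positivity)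
      (S.regime.three_mul_exp_le hj (by linarith) le_rfl)
      (fun i hi => S.prob_le_of_fewAbove hj hjk t hv.2 hi)
    refine this.trans (le_of_eq ?_)
    congr 1
    field_simp
    norm_num
  · rw [expPotential_zero_load]
    have : Real.exp (-(β * z)) ≤ 1 := Real.exp_le_one_iff.2 (by
      have := mul_nonneg hβ0.le hz
      linarith)
    calc (n : ℝ) * Real.exp (-(β * z)) ≤ n * 1 := by gcongr
      _ ≤ n * (16 * Real.exp β / β) := by gcongr
      _ = _ := by ring
  · calc (1 : ℝ) ≤ 1 * n := by linarith
      _ ≤ _ := by gcongr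
  · intro v hv
    have h1 : ∀ i, Real.exp (β * (excess v i - z)) ≤ Real.exp (β * (11000 * g ^ k)) := by
      intro i
      refine Real.exp_le_exp.2 (mul_le_mul_of_nonneg_left ?_ hβ0.le)
      linarith [(abs_le.1 (hv.1.abs_excess_le i)).2]
    calc expPotential β z v ≤ ∑ _i : Fin n, Real.exp (β * (11000 * g ^ k)) :=
          Finset.sum_le_sum fun i _ => h1 i
      _ = Real.exp (g ^ k) * Real.exp (β * (11000 * g ^ k)) := by rw [H.exp_pow]; simp
      _ = Real.exp (1 * g ^ k + β * (11000 * g ^ k)) := by rw [← Real.exp_add, one_mul]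
      _ ≤ Real.exp (β / (4 * n) * n ^ 3) := by
          refine Real.exp_le_exp.2 ?_
          calc 1 * g ^ k + β * (11000 * g ^ k) ≤ β * g ^ k + β * (11000 * g ^ k) := by
                gcongr; linarith
            _ = β * (11001 * g ^ k) := by ring
            _ ≤ β * (n / 4 * n) := by gcongr; linarith
            _ = β / (4 * n) * n ^ 3 := by field_simp
  · rw [div_le_iff₀ (Real.exp_pos _), ← Real.exp_add,
      show -(9 * g ^ k) + 11 * g ^ k = g ^ k + g ^ k by ring, Real.exp_add, H.exp_pow]
    have h1 : Real.exp β ≤ n := by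
      rw [← H.exp_pow]; exact Real.exp_le_exp.2 (by linarith)
    have h2 : 32 / β ≤ 1 := by rw [div_le_one hβ0]; linarith
    calc 2 * (16 * Real.exp β / β * n) = 32 / β * (Real.exp β * n) := by ring
      _ ≤ 1 * (n * n) := by gcongr
      _ = n * n := one_mul _

/-- Once the excess loads of the `j`-th layer are bounded, the potential of this layer with a
hundred times smaller exponent is concentrated, and few bins reach the next layer. -/
theorem next_layer_stage (S : ThinningSetup n k g P B rk) {j : ℕ} (hj : 1 ≤ j) (hjk : j < k)
    {c m : ℕ} (hc : c < 2 * k) :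
    P.real (goodOn (k + 1) (thinningReject k rk) B
        (fun v => BaseGood k g v ∧ FewAbove k g (j + 1) v) (m - c * n ^ 3) m)ᶜ ≤
      P.real (goodOn (k + 1) (thinningReject k rk) B
        (fun v => (BaseGood k g v ∧ FewAbove k g j v) ∧
          expPotential (g ^ j / 4) (layerLevel g j) v ≤ Real.exp (11 * g ^ k))
        (m - (c + 1) * n ^ 3) m)ᶜ + 1 / (n : ℝ) ^ 4 := by
  have H := S.regime
  have hn : (0 : ℝ) < n := by have := H.n_pos; positivity
  have hn1 := H.large_n
  have hX := H.large_pow H.one_le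
  have hx := H.large_pow hj
  have hxX := H.pow_le hjk.le
  have hXn := S.regime.pow_le_n
  have hg := H.large
  set β : ℝ := g ^ j / 400 with hβ
  have hz := layerLevel_nonneg (g := g) (by linarith) j
  set z := layerLevel g j with hzdef
  have hβ0 : 0 < β := by linarith
  have hexpβ := Real.add_one_le_exp β
  have hbig : (1 : ℝ) ≤ 16 * Real.exp β / β := by
    rw [le_div_iff₀ hβ0]; linarith
  set lam := Real.exp (-(g ^ k / 4)) with hlam
  have hlam0 : 0 < lam := Real.exp_pos _
  set r : ℝ := β / (4 * n) with hr
  have hr0 : 0 < r := by positivity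
  have hr1 : r ≤ 1 := by
    rw [hr, div_le_one (by positivity)]; linarith
  have hbr : 4 * Real.exp β / r = 16 * Real.exp β / β * n := by
    rw [hr]; field_simp; norm_num
  have hw : ∀ v : Fin n → ℕ, expPotential (g ^ j / 4) z v ≤ Real.exp (11 * g ^ k) →
      ∀ i, Real.exp (β * (excess v i - z)) ≤ Real.exp (0.11 * g ^ k) := by
    intro v hv i
    have h1 := Real.exp_le_exp.1 ((exp_le_expPotential (g ^ j / 4) z v i).trans hv)
    refine Real.exp_le_exp.2 ?_
    rw [hβ]
    linarith
  have hsmall : Real.exp (0.11 * g ^ k) * Real.exp β ≤ 2 * Real.exp (0.1125 * g ^ k) := by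
    rw [← Real.exp_add]
    have : Real.exp (0.11 * g ^ k + β) ≤ Real.exp (0.1125 * g ^ k) :=
      Real.exp_le_exp.2 (by rw [hβ]; linarith)
    linarith [Real.exp_pos (0.1125 * g ^ k)]
  have hsmall' : lam * (Real.exp (0.11 * g ^ k) * Real.exp β) ≤ 1 :=
    (mul_le_mul_of_nonneg_left hsmall hlam0.le).trans (S.regime.lam_mul_exp_le.trans (by norm_num))
  have h := S.stage
    (Good := fun v => (BaseGood k g v ∧ FewAbove k g j v) ∧
      expPotential (g ^ j / 4) z v ≤ Real.exp (11 * g ^ k))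
    (f := fun v => Real.exp (lam * expPotential β z v))
    (fun v => (Real.exp_pos _).le) (r := r) (b := Real.exp (lam * (16 * Real.exp β / β * n)))
    (K := Real.exp (lam * (32 * Real.exp β * n))) hr0.le hr1 (Real.exp_pos _)
    (fun t v hv => by
      have := sum_mul_exp_expPotential_le H.n_pos (fun i => recipientProb_nonneg t v i)
        (S.sum_prob t v) (S.prob_le t v) hβ0.le (by linarith) (by positivity)
        (S.regime.three_mul_exp_le hj (by linarith) (by linarith))
        (fun i hi => S.prob_le_of_fewAbove hj hjk t hv.1.2 hi) hlam0.le
        (fun i => le_trans (by gcongr lam * (?_ * Real.exp β); exact hw v hv.2 i) hsmall')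
      refine this.trans ((exp_mul_drift_le hr0 hr1).trans (le_of_eq ?_))
      rw [hbr])
    (by
      refine Real.exp_le_exp.2 (mul_le_mul_of_nonneg_left ?_ hlam0.le)
      rw [expPotential_zero_load]
      have : Real.exp (-(β * z)) ≤ 1 := Real.exp_le_one_iff.2 (by
        have := mul_nonneg hβ0.le hz
        linarith)
      calc (n : ℝ) * Real.exp (-(β * z)) ≤ n * 1 := by gcongr
        _ ≤ n * (16 * Real.exp β / β) := by gcongr
        _ = _ := by ring)
    (Real.one_le_exp (by positivity))
    (fun v hv => by
      refine Real.exp_le_exp.2 ?_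
      have h1 : expPotential β z v ≤ n * Real.exp (0.11 * g ^ k) := by
        calc expPotential β z v ≤ ∑ _i : Fin n, Real.exp (0.11 * g ^ k) :=
              Finset.sum_le_sum fun i _ => hw v hv.2 i
          _ = _ := by simp
      calc lam * expPotential β z v ≤ lam * (n * Real.exp (0.11 * g ^ k)) := by gcongr
        _ = n * (lam * (Real.exp (0.11 * g ^ k) * 1)) := by ring
        _ ≤ n * (lam * (Real.exp (0.11 * g ^ k) * Real.exp β)) := by gcongr; linarith
        _ ≤ n * 1 := by gcongr
        _ ≤ n * (β / 4 * n) := by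
            gcongr
            nlinarith
        _ = r * n ^ 3 := by rw [hr]; field_simp)
    (S.regime.two_mul_exp_div_le (by
      have : 16 * Real.exp β / β ≤ 16 * Real.exp β := div_le_self (by positivity) (by linarith)
      linarith)) (m := m) hc
  refine le_trans (measureReal_mono (Set.compl_subset_compl.2 ?_)) h
  intro ω hω s hs1 hs2
  obtain ⟨⟨⟨hv, -⟩, -⟩, hV⟩ := hω s hs1 hs2
  refine ⟨hv, ?_⟩
  set v := loadAt (k + 1) (thinningReject k rk) B s ω
  have hV' : expPotential β z v ≤ 32 * Real.exp β * n :=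
    le_of_mul_le_mul_left (Real.exp_le_exp.1 hV) hlam0
  have hcard := card_mul_exp_le_expPotential (β := β) (z := z) (z' := layerLevel g (j + 1))
    (by positivity) v
  have h2 : Real.exp (β * (layerLevel g (j + 1) - z)) = Real.exp (250 * g ^ (j + 1)) := by
    congr 1; rw [hβ, hzdef]; unfold layerLevel; push_cast; ring
  rw [h2] at hcard
  have h3 := H.le_rawQuantile (j := j + 1) (by omega)
  have hx1 : g ^ j ≤ g ^ (j + 1) := pow_le_pow_right₀ H.one_le_g (by omega)
  have h4 : 32 * Real.exp β * Real.exp (-(250 * g ^ (j + 1))) ≤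
      rawQuantile n (k + 1) (j + 1 + 1) := by
    refine le_trans ?_ h3
    have h5 : (32 : ℝ) ≤ Real.exp (g ^ j) := by linarith [Real.add_one_le_exp (g ^ j)]
    calc 32 * Real.exp β * Real.exp (-(250 * g ^ (j + 1)))
        ≤ Real.exp (g ^ j) * Real.exp β * Real.exp (-(250 * g ^ (j + 1))) := by gcongr
      _ = Real.exp (g ^ j + β - 250 * g ^ (j + 1)) := by
          rw [← Real.exp_add, ← Real.exp_add]; rfl
      _ ≤ _ := Real.exp_le_exp.2 (by rw [hβ]; linarith)
  unfold FewAbove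
  calc ((Finset.univ.filter fun i => layerLevel g (j + 1) ≤ excess v i).card : ℝ)
      = ((Finset.univ.filter fun i => layerLevel g (j + 1) ≤ excess v i).card : ℝ) *
          Real.exp (250 * g ^ (j + 1)) * Real.exp (-(250 * g ^ (j + 1))) := by
        rw [mul_assoc, ← Real.exp_add, add_neg_cancel, Real.exp_zero, mul_one]
    _ ≤ 32 * Real.exp β * n * Real.exp (-(250 * g ^ (j + 1))) :=
        mul_le_mul_of_nonneg_right (by linarith) (Real.exp_pos _).le
    _ = n * (32 * Real.exp β * Real.exp (-(250 * g ^ (j + 1)))) := by ring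
    _ ≤ _ := by gcongr

/-- The layered induction. -/
theorem fewAbove_window (S : ThinningSetup n k g P B rk) (m : ℕ) {j : ℕ} (hj : 1 ≤ j)
    (hjk : j < k) :
    P.real (goodOn (k + 1) (thinningReject k rk) B
        (fun v => BaseGood k g v ∧ FewAbove k g j v) (m - 2 * (k - j) * n ^ 3) m)ᶜ ≤
      2 * j / (n : ℝ) ^ 4 := by
  induction j, hj using Nat.le_induction with
  | base =>
    have h1 := S.few_stage (c := 2 * (k - 1)) (m := m) (by omega)
    have h2 := S.base_stage (c := 2 * (k - 1) + 1) (m := m) (by omega)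
    refine h1.trans ((add_le_add_left h2 _).trans (le_of_eq ?_))
    push_cast; ring
  | succ j hj ih =>
    have h1 := S.next_layer_stage hj (by omega) (c := 2 * (k - (j + 1))) (m := m) (by omega)
    have h2 := S.layer_stage hj (by omega) (c := 2 * (k - (j + 1)) + 1) (m := m) (by omega)
    have h3 := ih (by omega)
    rw [show 2 * (k - (j + 1)) + 1 + 1 = 2 * (k - j) by omega] at h2
    refine h1.trans ((add_le_add_left (h2.trans (add_le_add_left h3 _)) _).trans (le_of_eq ?_))
    push_cast; ring

/-- With high probability, all excess loads are of order `k * g` at time `m`. -/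
theorem excess_le (S : ThinningSetup n k g P B rk) (m : ℕ) :
    P.real {ω | ∀ i, excess (loadAt (k + 1) (thinningReject k rk) B m ω) i ≤ 100000 * k * g}ᶜ ≤
      1 / (n : ℝ) ^ 2 := by
  have H := S.regime
  have hn : (1 : ℝ) ≤ n := by exact_mod_cast H.n_pos
  have hg := H.large
  have hk := H.one_le
  have hfin : ((2 * k : ℕ) : ℝ) / (n : ℝ) ^ 4 ≤ 1 / (n : ℝ) ^ 2 := by
    have h1 : ((2 * k : ℕ) : ℝ) ≤ n := by exact_mod_cast S.regime.two_mul_k_le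
    rw [div_le_div_iff₀ (by positivity) (by positivity)]
    calc ((2 * k : ℕ) : ℝ) * (n : ℝ) ^ 2 ≤ n * (n : ℝ) ^ 2 := by gcongr
      _ = 1 * (n : ℝ) ^ 3 := by ring
      _ ≤ 1 * (n : ℝ) ^ 4 := by gcongr; norm_num
  refine le_trans ?_ hfin
  rcases hk.eq_or_lt with hk1 | hk1
  · have h := S.base_stage (c := 1) (m := m) (by omega)
    refine le_trans (measureReal_mono (Set.compl_subset_compl.2 ?_)) (h.trans ?_)
    · intro ω hω i
      have h1 := (abs_le.1 ((hω m (Nat.sub_le _ _) le_rfl).abs_excess_le i)).2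
      rw [← hk1] at h1 ⊢
      simp only [pow_one] at h1
      push_cast
      linarith
    · gcongr
      exact_mod_cast (by omega : 1 ≤ 2 * k)
  · obtain ⟨j, rfl⟩ : ∃ j, k = j + 1 := ⟨k - 1, by omega⟩
    have hj : 1 ≤ j := by omega
    have h1 := S.layer_stage hj (by omega) (c := 1) (m := m) (by omega)
    have h2 := S.fewAbove_window m hj (by omega)
    rw [show 2 * (j + 1 - j) = 1 + 1 by omega] at h2
    refine le_trans (measureReal_mono (Set.compl_subset_compl.2 ?_))
      ((h1.trans (add_le_add_left h2 _)).trans ?_)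
    · intro ω hω i
      have hv := (hω m (Nat.sub_le _ _) le_rfl).2
      set v := loadAt (j + 1 + 1) (thinningReject (j + 1) rk) B m ω
      have h3 := Real.exp_le_exp.1
        ((exp_le_expPotential (g ^ j / 4) (layerLevel g j) v i).trans hv)
      have hx := H.large_pow hj
      have h4 : excess v i - layerLevel g j ≤ 44 * g := by
        refine le_of_mul_le_mul_left ?_ (by linarith : (0 : ℝ) < g ^ j / 4)
        calc g ^ j / 4 * (excess v i - layerLevel g j) ≤ 11 * g ^ (j + 1) := h3
          _ = g ^ j / 4 * (44 * g) := by ring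
      unfold layerLevel at h4
      push_cast
      linarith
    · rw [← add_div]
      gcongr
      push_cast
      linarith

end ThinningSetup

theorem gap_le_of_excess_le {n : ℕ} (hn : 0 < n) {v : Fin n → ℕ} {m : ℕ} (hm : ∑ i, v i = m) {b : ℝ}
    (h : ∀ i, excess v i ≤ b) : gap v m ≤ b := by
  have : Nonempty (Fin n) := ⟨⟨0, hn⟩⟩
  unfold gap
  rw [sub_le_iff_le_add]
  refine ciSup_le fun i => ?_
  have h1 := h i
  have h2 : ∑ j, (v j : ℝ) = m := by exact_mod_cast hm
  unfold excess at h1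
  rw [h2] at h1
  linarith

end

theorem mainTheorem10 :
    ∃ c : ℝ, 0 < c ∧
      ∀ n d : ℕ, 2 ≤ d → (d : ℝ) < kappa * Real.log (Real.log n) →
      ∀ rk : ℕ → (Fin n → ℕ) → Equiv.Perm (Fin n), (∀ t x, IsRanking x (rk t x)) →
      ∀ (Ω : Type*) [MeasurableSpace Ω] (P : Measure Ω) [IsProbabilityMeasure P]
        (B : ℕ → ℕ → Ω → Fin n),
        (∀ t j, Measurable (B t j)) →
        (∀ t j b, P.real {ω | B t j ω = b} = 1 / (n : ℝ)) →
        iIndepFun (fun p : ℕ × ℕ => B p.1 p.2) P →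
      ∀ m : ℕ, 1 ≤ m →
        1 - 1 / (n : ℝ) ^ 2 ≤
          P.real {ω | gap (thinningLoad d (quantileReject (thinningQuantile n d) rk)
              (fun t j => B t j ω) m) m
            ≤ c * ((d : ℝ) - 1) * (Real.log n) ^ (1 / ((d : ℝ) - 1))} := by
  refine ⟨100000, by norm_num, ?_⟩
  intro n d hd hdn rk hrk Ω _ P _ B hB hunif hind m _
  have H := regime_of_lt_kappa hd hdn
  obtain ⟨k, rfl⟩ : ∃ k, d = k + 1 := ⟨d - 1, by omega⟩
  rw [Nat.add_sub_cancel] at H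
  have S : ThinningSetup n k _ P B rk := ⟨H, hrk, hB, hunif, hind⟩
  have hbad := S.excess_le m
  have hk : (((k + 1 : ℕ) : ℝ) - 1) = k := by push_cast; ring
  rw [hk] at hbad ⊢
  set A := {ω | ∀ i, excess (loadAt (k + 1) (thinningReject k rk) B m ω) i ≤
    100000 * k * (Real.log n) ^ (1 / (k : ℝ))} with hA
  have hsub : A ⊆ {ω | gap (thinningLoad (k + 1) (quantileReject (thinningQuantile n (k + 1)) rk)
      (fun t j => B t j ω) m) m ≤ 100000 * (k : ℝ) * (Real.log n) ^ (1 / (k : ℝ))} :=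
    fun ω hω => gap_le_of_excess_le H.n_pos (sum_loadAt (d := k + 1) m ω) hω
  have h1 : 1 ≤ P.real A + P.real Aᶜ := by
    rw [← probReal_univ (μ := P), ← Set.union_compl_self A]
    exact measureReal_union_le _ _
  have h2 := measureReal_mono (μ := P) hsub
  linarith
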